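/- **Energy identity for Smith maps.** Let $n\ge 2$. *Setting.* Let $\Sigma$ be a compact oriented smooth Riemannian $n$-manifold, possibly with boundary (or corners), with metric $g$, volume form $\mathsf{vol}$ and pointwise Hodge star $\ast:\Lambda^{n-1}T_x\Sigma\to T_x\Sigma$, $g(\ast(v_1\wedge\dots\wedge v_{n-1}),w)=\mathsf{vol}(v_1,\dots,v_{n-1},w)$. Let $(M,h)$ be a smooth Riemannian $m$-manifold without boundary, $m\ge n$, with an $(n-1)$-fold vector cross product $Q$: a smooth section of $\Lambda^{n-1}T^*M\otimes TM$ such that $Q(v_1\wedge\dots\wedge v_{n-1})$ is orthogonal to each $v_i$ and $|Q(v_1\wedge\dots\wedge v_{n-1})|^2=|v_1\wedge\dots\wedge v_{n-1}|^2=\det(h(v_i,v_j))$. Let $\alpha$ be the associated calibration $n$-form, $\alpha(v_1,\dots,v_n)=h(Q(v_1\wedge\dots\wedge v_{n-1}),v_n)$. For a smooth map $u:\Sigma\to M$ let $|du|$ be the Frobenius norm of the differential, $|du|^2=\sum_i|du(e_i)|^2$ for an orthonormal basis $(e_i)$ of $T_x\Sigma$, and let $$E_n(u)=\frac1{(\sqrt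 n)^n}\int_\Sigma|du|^n\,\mathsf{vol}$$ be the $n$-energy. The map $u$ is a *Smith map* if at every $x\in\Sigma$ there is $\lambda>0$ with $$Q(du\,v_1\wedge\dots\wedge du\,v_{n-1})=\lambda^{n-2}\,du(\ast(v_1\wedge\dots\wedge v_{n-1}))\qquad\text{for all }v_1,\dots,v_{n-1}\in T_x\Sigma .$$ *Statement.* 1. For every smooth $u:\Sigma\to M$, $$E_n(u)=\int_\Sigma\Big(\frac1{(\sqrt n)^n}|du|^n\,\mathsf{vol}-u^*\alpha\Big)+\int_\Sigma u^*\alpha ,$$ and the first term on the right is nonnegative; it vanishes if and only if $u$ is a Smith map. 2. Suppose $d\alpha=0$. Then a smooth map $u$ is a Smith map if and only if $E_n(u)=\int_\Sigma u^*\alpha$. 3. Suppose $d\alpha=0$ and $\partial\Sigma=\varnothing$. Let $R$ be $\mathbb Z$ or $\mathbb R$ (or any commutative ring with a ring homomorphism to $\mathbb R$), let $H_n(\,\cdot\,;R)$ be (smooth) singular homology, and let $[\Sigma]\in H_n(\Sigma;R)$ be the fundamental class, that is, the class which for every $x\in\Sigma$ restricts to the generator of $H_n(\Sigma,\Sigma\setminus\{x\};R)$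 given by the orientation. Then: - for every smooth $u:\Sigma\to M$, $\int_\Sigma u^*\alpha=[\alpha]\cdot u_*[\Sigma]$, where $[\alpha]\in H^n(M,\mathbb R)$ is the de Rham class of $\alpha$ and the dot is the de Rham pairing $H^n(M,\mathbb R)\times H_n(M;R)\to\mathbb R$ (integration of a closed form over a smooth singular cycle); - this number depends only on $[\alpha]$ and $u_*[\Sigma]$: if $u,v:\Sigma\to M$ are smooth with $v_*[\Sigma]=u_*[\Sigma]$ in $H_n(M;R)$ and $\beta$ is a closed smooth $n$-form on $M$ with $[\beta]=[\alpha]$, then $\int_\Sigma v^*\beta=\int_\Sigma u^*\alpha$; - a smooth map $u$ is a Smith map if and only if $E_n(u)=[\alpha]\cdot u_*[\Sigma]$; - if $u$ is a Smith map, then $E_n(u)\le E_n(v)$ for every smooth $v:\Sigma\to M$ with $v_*[\Sigma]=u_*[\Sigma]$ in $H_n(M;R)$. -/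

import Mathlib

open Bundle
open scoped Manifold ContDiff

set_option maxSynthPendingDepth 3

noncomputable section

/-! ### Linear algebra: vector cross products, Hodge star, Smith maps -/

section LinearAlgebra

variable {V W : Type*} [NormedAddCommGroup V] [InnerProductSpace ℝ V]
  [NormedAddCommGroup W] [InnerProductSpace ℝ W]

/-- `P` is a `k`-fold vector cross product: `P (v₁ ∧ ⋯ ∧ v_k)` is orthogonal to every `v_i`, and
`|P (v₁ ∧ ⋯ ∧ v_k)|² = |v₁ ∧ ⋯ ∧ v_k|²`, the Gram determinant of `v₁, …, v_k`. -/
structure IsVectorCrossProduct {k : ℕ} (P : W [⋀^Fin k]→L[ℝ] W) : Prop where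
  inner_eq_zero : ∀ (v : Fin k → W) (i : Fin k), inner ℝ (P v) (v i) = 0
  norm_sq : ∀ v : Fin k → W, ‖P v‖ ^ 2 = (Matrix.gram ℝ v).det

/-- `θ` is one of the two unit-length top-degree forms of an `n`-dimensional Euclidean space:
`θ(v₁, …, vₙ)² = |v₁ ∧ ⋯ ∧ vₙ|²`. Such a form is the same thing as an orientation; a basis is
oriented when `θ` is positive on it. -/
def IsUnitVolume {n : ℕ} (θ : V [⋀^Fin n]→L[ℝ] ℝ) : Prop :=
  ∀ v : Fin n → V, θ v ^ 2 = (Matrix.gram ℝ v).det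

variable [FiniteDimensional ℝ V]

/-- The Hodge star `Λᵏ V → V` of an oriented Euclidean space of dimension `k + 1` with volume form
`θ`: the vector characterized by `⟪*(v₁ ∧ ⋯ ∧ v_k), w⟫ = θ (v₁, …, v_k, w)` for all `w`. -/
def hodgeStar {k : ℕ} (θ : V [⋀^Fin (k + 1)]→L[ℝ] ℝ) (v : Fin k → V) : V :=
  ∑ i, θ (Fin.snoc v (stdOrthonormalBasis ℝ V i)) • stdOrthonormalBasis ℝ V i

/-- The Frobenius (Hilbert–Schmidt) norm `|A| = √(∑ᵢ |A eᵢ|²)` of a linear map. -/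
def frobeniusNorm (A : V →L[ℝ] W) : ℝ :=
  √(∑ i, ‖A (stdOrthonormalBasis ℝ V i)‖ ^ 2)

/-- `A : V → W` is a Smith map, for `V` an oriented Euclidean space of dimension `k + 1` with
volume form `θ`, and `W` with `k`-fold vector cross product `Q`: for some `c > 0`,
`Q (A v₁ ∧ ⋯ ∧ A v_k) = c^(k-1) A (*(v₁ ∧ ⋯ ∧ v_k))`. -/
def IsLinearSmithMap {k : ℕ} (θ : V [⋀^Fin (k + 1)]→L[ℝ] ℝ) (Q : W [⋀^Fin k]→L[ℝ] W)
    (A : V →L[ℝ] W) : Prop :=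
  ∃ c : ℝ, 0 < c ∧ ∀ v : Fin k → V, Q (fun i => A (v i)) = c ^ (k - 1) • A (hodgeStar θ v)

end LinearAlgebra

/-! ### Differential forms on manifolds and de Rham cohomology -/

section Forms

variable {E : Type*} [NormedAddCommGroup E] [NormedSpace ℝ E]
  {H : Type*} [TopologicalSpace H] (I : ModelWithCorners ℝ E H)
  (M : Type*) [TopologicalSpace M] [ChartedSpace H M]

instance (x : M) [FiniteDimensional ℝ E] : FiniteDimensional ℝ (TangentSpace I x) :=
  inferInstanceAs (FiniteDimensional ℝ E)

/-- Differential `k`-forms on `M` (with no regularity). -/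
abbrev DiffForm (k : ℕ) : Type _ := (x : M) → TangentSpace I x [⋀^Fin k]→L[ℝ] ℝ

variable {I M}

/-- The coordinate expression of `θ` in the preferred chart at `p`, that is, the pullback of `θ`
by the inverse of that chart. -/
def DiffForm.inChart {k : ℕ} (θ : DiffForm I M k) (p : M) (y : E) : E [⋀^Fin k]→L[ℝ] ℝ :=
  (θ ((extChartAt I p).symm y)).compContinuousLinearMap
    (mfderivWithin 𝓘(ℝ, E) I (extChartAt I p).symm (Set.range I) y)

theorem DiffForm.inChart_add {k : ℕ} (θ η : DiffForm I M k) (p : M) :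
    DiffForm.inChart (θ + η) p = DiffForm.inChart θ p + DiffForm.inChart η p := rfl

theorem DiffForm.inChart_smul {k : ℕ} (c : ℝ) (θ : DiffForm I M k) (p : M) :
    DiffForm.inChart (c • θ) p = c • DiffForm.inChart θ p := rfl

variable (I M) in
/-- The space `Ωᵏ(M)` of smooth `k`-forms: smooth in every chart. -/
def smoothForms (k : ℕ) : Submodule ℝ (DiffForm I M k) where
  carrier := {θ | ∀ p : M, ContDiffOn ℝ ∞ (DiffForm.inChart θ p) (extChartAt I p).target}
  add_mem' := fun ha hb p => by
    rw [DiffForm.inChart_add]; exact (ha p).add (hb p)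
  zero_mem' := fun p => by
    have : DiffForm.inChart (0 : DiffForm I M k) p = fun _ => 0 := rfl
    rw [this]; exact contDiffOn_const
  smul_mem' := fun c a ha p => by
    rw [DiffForm.inChart_smul]; exact contDiffOn_const.smul (ha p)

theorem smoothForms.differentiableWithinAt {k : ℕ} (θ : smoothForms I M k) (x : M) :
    DifferentiableWithinAt ℝ (DiffForm.inChart θ.1 x) (Set.range I) (extChartAt I x x) := by
  have h := (θ.2 x) _ (mem_extChartAt_target x)
  exact (h.differentiableWithinAt (by simp)).mono_of_mem_nhdsWithin
    (extChartAt_target_mem_nhdsWithin x)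

variable (I M) in
/-- The exterior derivative; `(dθ)ₓ` is computed in the preferred chart at `x`. -/
def extD (k : ℕ) : smoothForms I M k →ₗ[ℝ] DiffForm I M (k + 1) where
  toFun θ := fun x =>
    (extDerivWithin (DiffForm.inChart θ.1 x) (Set.range I)
      (extChartAt I x x)).compContinuousLinearMap (mfderiv I 𝓘(ℝ, E) (extChartAt I x) x)
  map_add' θ η := by
    funext x
    have h := extDerivWithin_add (𝕜 := ℝ)
      (I.uniqueDiffOn _ (Set.mem_range_self (chartAt H x x)))
      (smoothForms.differentiableWithinAt θ x) (smoothForms.differentiableWithinAt η x)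
    have h' : extDerivWithin (DiffForm.inChart (θ + η).1 x) (Set.range I) (extChartAt I x x) =
        extDerivWithin (DiffForm.inChart θ.1 x) (Set.range I) (extChartAt I x x) +
        extDerivWithin (DiffForm.inChart η.1 x) (Set.range I) (extChartAt I x x) := h
    rw [h']; rfl
  map_smul' c θ := by
    funext x
    have h := extDerivWithin_smul (𝕜 := ℝ) c (DiffForm.inChart θ.1 x)
      (I.uniqueDiffOn _ (Set.mem_range_self (chartAt H x x)))
    have h' : extDerivWithin (DiffForm.inChart (c • θ).1 x) (Set.range I) (extChartAt I x x) =
        c • extDerivWithin (DiffForm.inChart θ.1 x) (Set.range I) (extChartAt I x x) := h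
    rw [h']; rfl

variable (I M) in
/-- Closed smooth `k`-forms. -/
def closedForms (k : ℕ) : Submodule ℝ (smoothForms I M k) := LinearMap.ker (extD I M k)

variable (I M) in
/-- Exact forms, as a subspace of the closed forms of degree `k + 1`. -/
def exactForms (k : ℕ) : Submodule ℝ (closedForms I M (k + 1)) :=
  (LinearMap.range (extD I M k)).comap
    ((smoothForms I M (k + 1)).subtype ∘ₗ (closedForms I M (k + 1)).subtype)

variable (I M) in
/-- The de Rham cohomology `H^(k+1)(M, ℝ)`. -/
abbrev DeRhamCohomology (k : ℕ) : Type _ := closedForms I M (k + 1) ⧸ exactForms I M k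

/-- The de Rham class of a closed form. -/
def deRhamClass {k : ℕ} (α : closedForms I M (k + 1)) : DeRhamCohomology I M k :=
  (exactForms I M k).mkQ α

variable {E' : Type*} [NormedAddCommGroup E'] [NormedSpace ℝ E']
  {H' : Type*} [TopologicalSpace H'] {J : ModelWithCorners ℝ E' H'}
  {N : Type*} [TopologicalSpace N] [ChartedSpace H' N]

/-- The pullback `u^* α` of a form by a smooth map. -/
def DiffForm.pullback {k : ℕ} (u : C^∞⟮J, N; I, M⟯) (α : DiffForm I M k) : DiffForm J N k :=
  fun x => (α (u x)).compContinuousLinearMap (mfderiv J I u x)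

end Forms

/-! ### Smooth singular homology -/

section Homology

variable {E : Type*} [NormedAddCommGroup E] [NormedSpace ℝ E]
  {H : Type*} [TopologicalSpace H] (I : ModelWithCorners ℝ E H)
  (M : Type*) [TopologicalSpace M] [ChartedSpace H M]

/-- Smooth singular `n`-simplices of `M`: maps from the standard simplex
`Δⁿ = {t ∈ ℝⁿ⁺¹ | tᵢ ≥ 0, ∑ tᵢ = 1}` that extend to a smooth map on a neighbourhood of `Δⁿ`. -/
def SmoothSimplex (n : ℕ) : Type _ :=
  {σ : stdSimplex ℝ (Fin (n + 1)) → M //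
    ∃ (f : (Fin (n + 1) → ℝ) → M) (U : Set (Fin (n + 1) → ℝ)), IsOpen U ∧
      stdSimplex ℝ (Fin (n + 1)) ⊆ U ∧ ContMDiffOn 𝓘(ℝ, Fin (n + 1) → ℝ) I ∞ f U ∧
      ∀ t : stdSimplex ℝ (Fin (n + 1)), f t = σ t}

variable {I M}

/-- A smooth extension of a smooth singular simplex to a neighbourhood of the standard simplex. -/
def SmoothSimplex.extension {n : ℕ} (σ : SmoothSimplex I M n) : (Fin (n + 1) → ℝ) → M :=
  σ.2.choose

/-- The `i`-th face of a smooth singular simplex, opposite to the vertex `eᵢ`. -/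
def SmoothSimplex.face {n : ℕ} (σ : SmoothSimplex I M (n + 1)) (i : Fin (n + 2)) :
    SmoothSimplex I M n :=
  ⟨fun t => σ.1 (stdSimplex.map (Fin.succAbove i) t), by
    obtain ⟨f, U, hU, hsub, hf, hσ⟩ := σ.2
    let L : (Fin (n + 1) → ℝ) →L[ℝ] (Fin (n + 2) → ℝ) :=
      LinearMap.toContinuousLinearMap (FunOnFinite.linearMap ℝ ℝ (Fin.succAbove i))
    have hL : ∀ t : stdSimplex ℝ (Fin (n + 1)),
        L t = (stdSimplex.map (Fin.succAbove i) t : stdSimplex ℝ (Fin (n + 2))) := fun t => rfl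
    refine ⟨f ∘ L, L ⁻¹' U, hU.preimage L.continuous, ?_, ?_, ?_⟩
    · intro t ht
      exact hsub (stdSimplex.map (Fin.succAbove i) ⟨t, ht⟩).2
    · exact hf.comp L.contMDiff.contMDiffOn (fun _ h => h)
    · intro t
      rw [Function.comp_apply, hL]; exact hσ _⟩

/-- The vectors `eⱼ - e₀`, `j = 1, …, n`, a frame of the standard `n`-simplex. -/
def simplexFrame (n : ℕ) (j : Fin n) : Fin (n + 1) → ℝ :=
  Pi.single j.succ 1 - Pi.single 0 1

/-- The standard affine parametrization `t ↦ (1 - ∑ tᵢ, t₁, …, tₙ)` of the standard simplex. -/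
def simplexParam (n : ℕ) (t : Fin n → ℝ) : Fin (n + 1) → ℝ := Fin.cons (1 - ∑ i, t i) t

/-- `{t ∈ ℝⁿ | tᵢ ≥ 0, ∑ tᵢ ≤ 1}`, the parameter domain of the standard simplex. -/
def simplexDomain (n : ℕ) : Set (Fin n → ℝ) := {t | (∀ i, 0 ≤ t i) ∧ ∑ i, t i ≤ 1}

/-- The value of `σ^* θ` on the coordinate frame `∂/∂t₁, …, ∂/∂tₙ` at the parameter `t`. -/
def SmoothSimplex.pullbackDensity {n : ℕ} (σ : SmoothSimplex I M n) (θ : DiffForm I M n)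
    (t : Fin n → ℝ) : ℝ :=
  θ (σ.extension (simplexParam n t)) fun j =>
    mfderiv 𝓘(ℝ, Fin (n + 1) → ℝ) I σ.extension (simplexParam n t) (simplexFrame n j)

/-- The integral `∫_σ θ = ∫_{Δⁿ} σ^* θ`. -/
def SmoothSimplex.integral {n : ℕ} (θ : DiffForm I M n) (σ : SmoothSimplex I M n) : ℝ :=
  ∫ t in simplexDomain n, σ.pullbackDensity θ t

variable (I M) (R : Type*) [CommRing R]

/-- Smooth singular `n`-chains with coefficients in `R`. -/
abbrev SmoothChain (n : ℕ) : Type _ := SmoothSimplex I M n →₀ R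

/-- The singular boundary `∂σ = ∑ᵢ (-1)ⁱ σ ∘ dᵢ`. -/
def chainBoundary (n : ℕ) : SmoothChain I M R (n + 1) →ₗ[R] SmoothChain I M R n :=
  Finsupp.linearCombination R fun σ : SmoothSimplex I M (n + 1) =>
    ∑ i : Fin (n + 2), Finsupp.single (σ.face i) ((-1 : R) ^ (i : ℕ))

/-- Cycles of degree `k + 1`. -/
def smoothCycles (k : ℕ) : Submodule R (SmoothChain I M R (k + 1)) :=
  LinearMap.ker (chainBoundary I M R k)

/-- Boundaries, as a submodule of the cycles of degree `k + 1`. -/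
def smoothBoundaries (k : ℕ) : Submodule R (smoothCycles I M R k) :=
  (LinearMap.range (chainBoundary I M R (k + 1))).comap (smoothCycles I M R k).subtype

/-- The (smooth) singular homology `H_(k+1)(M; R)`. -/
abbrev SmoothHomology (k : ℕ) : Type _ := smoothCycles I M R k ⧸ smoothBoundaries I M R k

variable {I M R}

/-- The integral of a form over a chain. -/
def chainIntegral [Algebra R ℝ] {n : ℕ} (θ : DiffForm I M n) (c : SmoothChain I M R n) : ℝ :=
  c.sum fun σ r => algebraMap R ℝ r * σ.integral θ

/-- The de Rham pairing `H^(k+1)(M, ℝ) × H_(k+1)(M; R) → ℝ`: integrate a closed form representing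
the cohomology class over a cycle representing the homology class. -/
def deRhamPairing [Algebra R ℝ] {k : ℕ} (a : DeRhamCohomology I M k)
    (z : SmoothHomology I M R k) : ℝ :=
  chainIntegral (Quotient.out a).1.1 (Quotient.out z).1

section Pushforward

variable {E' : Type*} [NormedAddCommGroup E'] [NormedSpace ℝ E']
  {H' : Type*} [TopologicalSpace H'] {J : ModelWithCorners ℝ E' H'}
  {N : Type*} [TopologicalSpace N] [ChartedSpace H' N]

/-- The composition `u ∘ σ`. -/
def SmoothSimplex.push {n : ℕ} (u : C^∞⟮J, N; I, M⟯) (σ : SmoothSimplex J N n) :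
    SmoothSimplex I M n :=
  ⟨fun t => u (σ.1 t), by
    obtain ⟨f, U, hU, hsub, hf, hσ⟩ := σ.2
    exact ⟨u ∘ f, U, hU, hsub, u.contMDiff.comp_contMDiffOn hf, fun t => by simp [hσ]⟩⟩

variable (R) in
/-- The induced map on chains. -/
def pushChain (u : C^∞⟮J, N; I, M⟯) (n : ℕ) : SmoothChain J N R n →ₗ[R] SmoothChain I M R n :=
  Finsupp.lmapDomain R R (SmoothSimplex.push u)

theorem chainBoundary_pushChain (u : C^∞⟮J, N; I, M⟯) (n : ℕ) (c : SmoothChain J N R (n + 1)) :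
    chainBoundary I M R n (pushChain R u (n + 1) c) =
      pushChain R u n (chainBoundary J N R n c) := by
  induction c using Finsupp.induction_linear with
  | zero => simp
  | add f g hf hg => simp [hf, hg]
  | single σ r =>
    simp only [chainBoundary, pushChain, Finsupp.lmapDomain_apply, Finsupp.mapDomain_single,
      Finsupp.linearCombination_single, map_smul, map_sum]
    rfl

variable (R) in
/-- The induced map on cycles. -/
def pushCycle (u : C^∞⟮J, N; I, M⟯) (k : ℕ) : smoothCycles J N R k →ₗ[R] smoothCycles I M R k :=
  (pushChain R u (k + 1)).restrict fun c hc => by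
    rw [smoothCycles, LinearMap.mem_ker] at hc ⊢
    rw [chainBoundary_pushChain, hc, map_zero]

/-- The pushforward homomorphism `u_* : H_(k+1)(N; R) → H_(k+1)(M; R)`. -/
def pushHomology (u : C^∞⟮J, N; I, M⟯) {k : ℕ} :
    SmoothHomology J N R k →ₗ[R] SmoothHomology I M R k :=
  Submodule.mapQ _ _ (pushCycle R u k) (by
    rintro ⟨c, hc⟩ ⟨b, hb⟩
    exact ⟨pushChain R u (k + 2) b, by rw [chainBoundary_pushChain, hb]; rfl⟩)

end Pushforward

end Homology

/-! ### Oriented Riemannian manifolds, integration, fundamental class -/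

section Oriented

variable {n : ℕ} {H : Type*} [TopologicalSpace H]
  (I : ModelWithCorners ℝ (EuclideanSpace ℝ (Fin n)) H)
  (S : Type*) [TopologicalSpace S] [ChartedSpace H S]

/-- The volume form of an oriented Riemannian `n`-manifold `S`. An orientation of `S` is
given by, and is encoded as, this smooth unit-length `n`-form. -/
structure RiemannianVolumeForm [RiemannianBundle (fun x : S => TangentSpace I x)] where
  form : DiffForm I S n
  smooth : form ∈ smoothForms I S n
  unit : ∀ x, IsUnitVolume (form x)

variable {I S} [RiemannianBundle (fun x : S => TangentSpace I x)]

/-- The coefficient of a top-degree form in the preferred chart at `p`: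
`θ = (DiffForm.coeff θ p) dy₁ ∧ ⋯ ∧ dyₙ`. -/
def DiffForm.coeff (θ : DiffForm I S n) (p : S) (y : EuclideanSpace ℝ (Fin n)) : ℝ :=
  DiffForm.inChart θ p y fun i => EuclideanSpace.single i 1

/-- A smooth partition of unity subordinate to the atlas of preferred charts. -/
def chartPartition (I : ModelWithCorners ℝ (EuclideanSpace ℝ (Fin n)) H) (S : Type*)
    [TopologicalSpace S] [ChartedSpace H S] [IsManifold I ∞ S] [T2Space S] [SigmaCompactSpace S] :
    SmoothPartitionOfUnity S I S Set.univ :=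
  (SmoothPartitionOfUnity.exists_isSubordinate_chartAt_source I S).choose

/-- The integral `∫_S θ` of a top-degree form over an oriented manifold: the sum over a partition
of unity subordinate to the charts of the integrals of the coordinate expressions, each taken with
the sign `±1` according to whether the chart preserves or reverses the orientation. -/
def integralForm [IsManifold I ∞ S] [T2Space S] [SigmaCompactSpace S]
    (vol : RiemannianVolumeForm I S) (θ : DiffForm I S n) : ℝ :=
  ∑ᶠ p : S, ∫ y in (extChartAt I p).target,
    Real.sign (DiffForm.coeff vol.form p y) *
      (chartPartition I S p ((extChartAt I p).symm y) * DiffForm.coeff θ p y)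

/-- `τ` is a positively oriented embedded simplex containing `x` in its interior (so that its class
in `H_n(S, S ∖ {x})` is the generator given by the orientation). -/
def SmoothSimplex.IsOrientedAt (vol : RiemannianVolumeForm I S) (τ : SmoothSimplex I S n)
    (x : S) : Prop :=
  Function.Injective τ.1 ∧
  (∀ t ∈ simplexDomain n, 0 < τ.pullbackDensity vol.form t) ∧
  ∃ t : stdSimplex ℝ (Fin (n + 1)), (∀ i, 0 < (t : Fin (n + 1) → ℝ) i) ∧ τ.1 t = x

end Oriented

section Main

variable {k : ℕ} {H : Type*} [TopologicalSpace H]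
  {I : ModelWithCorners ℝ (EuclideanSpace ℝ (Fin (k + 1))) H}
  {S : Type*} [TopologicalSpace S] [ChartedSpace H S]
  [RiemannianBundle (fun x : S => TangentSpace I x)]

/-- `z` is the fundamental class `[S]` of a closed oriented manifold `S` of dimension `k + 1`: for
every `x`, its image in `H_(k+1)(S, S ∖ {x}; R)` is the generator given by the orientation, that
is, `z` has a representative cycle of the form `τ + c' + ∂b` with `τ` a positively oriented
embedded simplex around `x` and `c'` a chain in `S ∖ {x}`. -/
def IsFundamentalClass {R : Type*} [CommRing R] (vol : RiemannianVolumeForm I S)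
    (z : SmoothHomology I S R k) : Prop :=
  ∀ x : S, ∃ (c : smoothCycles I S R k) (τ : SmoothSimplex I S (k + 1))
    (c' : SmoothChain I S R (k + 1)) (b : SmoothChain I S R (k + 2)),
    (smoothBoundaries I S R k).mkQ c = z ∧ τ.IsOrientedAt vol x ∧
    (∀ σ ∈ c'.support, x ∉ Set.range σ.1) ∧
    (c : SmoothChain I S R (k + 1)) = Finsupp.single τ 1 + c' + chainBoundary I S R (k + 1) b

/-- A `k`-fold vector cross product `Q` on a Riemannian manifold `M` together with its associated
calibration form `α(v₁, …, v_(k+1)) = h(Q(v₁ ∧ ⋯ ∧ v_k), v_(k+1))`. As the metric is smooth, `Q` is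
smooth if and only if `α` is. -/
structure VectorCrossProductStructure (k m : ℕ) (M : Type*) [TopologicalSpace M]
    [ChartedSpace (EuclideanSpace ℝ (Fin m)) M]
    [RiemannianBundle (fun y : M => TangentSpace (𝓡 m) y)] where
  Q : (y : M) → TangentSpace (𝓡 m) y [⋀^Fin k]→L[ℝ] TangentSpace (𝓡 m) y
  isVectorCrossProduct : ∀ y, IsVectorCrossProduct (Q y)
  α : smoothForms (𝓡 m) M (k + 1)
  α_apply : ∀ (y : M) (v : Fin k → TangentSpace (𝓡 m) y) (w : TangentSpace (𝓡 m) y),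
    α.1 y (Fin.snoc v w) = inner ℝ (Q y v) w

variable {m : ℕ} {M : Type*} [TopologicalSpace M] [ChartedSpace (EuclideanSpace ℝ (Fin m)) M]
  [RiemannianBundle (fun y : M => TangentSpace (𝓡 m) y)]

/-- `u : S → M` is a Smith map: every differential `(du)ₓ` is a linear Smith map. -/
def IsSmithMap (vol : RiemannianVolumeForm I S) (X : VectorCrossProductStructure k m M)
    (u : C^∞⟮I, S; 𝓡 m, M⟯) : Prop :=
  ∀ x : S, IsLinearSmithMap (vol.form x) (X.Q (u x)) (mfderiv I (𝓡 m) u x)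

/-- The top-degree form `|du|ⁿ vol / (√n)ⁿ`, where `n = k + 1`. -/
def energyForm (vol : RiemannianVolumeForm I S) (u : C^∞⟮I, S; 𝓡 m, M⟯) :
    DiffForm I S (k + 1) :=
  fun x => (1 / √((k + 1 : ℕ) : ℝ) ^ (k + 1) *
    frobeniusNorm (mfderiv I (𝓡 m) u x) ^ (k + 1)) • vol.form x

/-- The `n`-energy `E_n(u) = (√n)^(-n) ∫_S |du|ⁿ vol`, where `n = k + 1`. -/
def nEnergy [IsManifold I ∞ S] [T2Space S] [SigmaCompactSpace S]
    (vol : RiemannianVolumeForm I S) (u : C^∞⟮I, S; 𝓡 m, M⟯) : ℝ :=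
  integralForm vol (energyForm vol u)

end Main

end

set_option linter.unusedSectionVars false

noncomputable section

/-! ### The pointwise energy inequality -/

/-! The heart is a pointwise inequality. Let `A = du` at a point and `n = k + 1`. Diagonalizing
`A^*A` gives an oriented orthonormal basis `e` whose images under `A` are mutually orthogonal.
Cauchy–Schwarz, the norm identity for `Q` and the AM–GM inequality then give `α(A e₁, …, A eₙ) ≤
|Q(A e₁ ∧ ⋯ ∧ A e_k)| |A eₙ| = ∏ |A eᵢ| ≤ (|A|² / n)^(n/2) = |A|ⁿ / (√n)ⁿ`. Equality in AM–GM makes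
`A` conformal, and equality in Cauchy–Schwarz then gives the Smith equation; conversely the Smith
equation forces both equalities (`IsVectorCrossProduct.calibration_le`).

Hence the energy form minus `u^*α` is a nonnegative top-degree form with continuous coefficients.
Its integral is nonnegative, and it vanishes only if the form vanishes at every point, that is, if
`u` is a Smith map (`energy_identity`). The first two statements follow.

For the homological statements it remains to identify `∫ u^*α`, defined by a partition of unity,
with the de Rham pairing, defined by smooth singular chains. Stokes' theorem on simplices
(`SmoothSimplex.integral_extD`) makes the pairing independent of representatives, and the chain rule
makes it natural under pushforward. The remaining link is `IsFundamentalClass.integralForm_eq`: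
integration over the manifold is integration over a cycle representing the fundamental class. By a
second partition of unity this needs checking only for forms supported near one point `x`. There the
cycle may be replaced by one positively oriented embedded simplex: boundaries contribute nothing
because top-degree forms are closed, and the rest of the cycle misses the support. Over that
simplex, the change of variables formula gives the equality. -/

theorem prod_le_sum_div_pow {n : ℕ} (hn : n ≠ 0) (z : Fin n → ℝ) (hz : ∀ i, 0 ≤ z i) :
    ∏ i, z i ≤ ((∑ i, z i) / n) ^ n ∧
      (∏ i, z i = ((∑ i, z i) / n) ^ n → ∀ j, z j = (∑ i, z i) / n) := by
  have hn' : (n : ℝ) ≠ 0 := Nat.cast_ne_zero.2 hn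
  have hw : ∀ i ∈ Finset.univ, (0 : ℝ) ≤ (fun _ : Fin n => (n : ℝ)⁻¹) i := fun _ _ => by positivity
  have hw1 : ∑ i : Fin n, (fun _ : Fin n => (n : ℝ)⁻¹) i = 1 := by simp [hn']
  have key := Real.geom_mean_le_arith_mean_weighted Finset.univ _ z hw hw1 fun i _ => hz i
  have heq := Real.geom_mean_eq_arith_mean_weighted_iff_of_nonneg' Finset.univ _ z hw hw1
    fun i _ => hz i
  have hsum : ∑ i, (n : ℝ)⁻¹ * z i = (∑ i, z i) / n := by
    rw [← Finset.mul_sum, div_eq_inv_mul]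
  have hprod : (∏ i, z i ^ (n : ℝ)⁻¹) ^ n = ∏ i, z i := by
    rw [← Finset.prod_pow]
    exact Finset.prod_congr rfl fun i _ => Real.rpow_inv_natCast_pow (hz i) hn
  have hnn : 0 ≤ ∏ i, z i ^ (n : ℝ)⁻¹ := Finset.prod_nonneg fun i _ => Real.rpow_nonneg (hz i) _
  have hnn' : 0 ≤ (∑ i, z i) / n := div_nonneg (Finset.sum_nonneg fun i _ => hz i) (by positivity)
  simp only [hsum] at key heq
  refine ⟨by rw [← hprod]; exact pow_le_pow_left₀ hnn key n, fun h j => ?_⟩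
  rw [← hprod] at h
  have h' := (pow_left_inj₀ hnn hnn' hn).1 h
  exact heq.1 h' j (Finset.mem_univ j) (by simpa using hn)

section LinearAlgebra

variable {V W : Type*} [NormedAddCommGroup V] [InnerProductSpace ℝ V]
  [NormedAddCommGroup W] [InnerProductSpace ℝ W]

theorem Matrix.det_gram_of_orthogonal {n : ℕ} (v : Fin n → V)
    (h : ∀ i j, i ≠ j → inner ℝ (v i) (v j) = 0) : (Matrix.gram ℝ v).det = ∏ i, ‖v i‖ ^ 2 := by
  have : Matrix.gram ℝ v = Matrix.diagonal fun i => ‖v i‖ ^ 2 := by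
    ext i j
    rw [Matrix.gram_apply, Matrix.diagonal_apply]
    split_ifs with hij
    · subst hij; exact real_inner_self_eq_norm_sq _
    · exact h i j hij
  rw [this, Matrix.det_diagonal]

theorem Matrix.det_gram_snoc_of_orthogonal {k : ℕ} (v : Fin k → V) (w : V)
    (h : ∀ i, inner ℝ (v i) w = 0) :
    (Matrix.gram ℝ (Fin.snoc v w : Fin (k + 1) → V)).det = (Matrix.gram ℝ v).det * ‖w‖ ^ 2 := by
  rw [Matrix.det_succ_row _ (Fin.last k), Fin.sum_univ_castSucc, Finset.sum_eq_zero, zero_add]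
  · have : ((Matrix.gram ℝ (Fin.snoc v w : Fin (k + 1) → V)).submatrix (Fin.last k).succAbove
        (Fin.last k).succAbove) = Matrix.gram ℝ v := by
      ext i j
      simp [Matrix.gram_apply]
    rw [this, Matrix.gram_apply]
    rw [Even.neg_one_pow ⟨_, rfl⟩, one_mul, Fin.snoc_last, real_inner_self_eq_norm_sq, mul_comm]
  · intro j _
    simp [Matrix.gram_apply, real_inner_comm (v j) w, h j]

theorem ContinuousAlternatingMap.eq_apply_basis_mul_det {F : Type*} [AddCommGroup F] [Module ℝ F]
    [TopologicalSpace F] {n : ℕ} (e : Module.Basis (Fin n) ℝ F) (θ : F [⋀^Fin n]→L[ℝ] ℝ)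
    (v : Fin n → F) : θ v = θ e * e.det v := by
  have := AlternatingMap.eq_smul_basis_det e θ.toAlternatingMap
  exact congrArg (fun f : F [⋀^Fin n]→ₗ[ℝ] ℝ => f v) this

/-- Any two top-degree forms are proportional. -/
theorem IsUnitVolume.apply_eq {n : ℕ} {θ η : V [⋀^Fin n]→L[ℝ] ℝ}
    {e : OrthonormalBasis (Fin n) ℝ V} (he : θ e = 1) (v : Fin n → V) : η v = η e * θ v := by
  have h1 := ContinuousAlternatingMap.eq_apply_basis_mul_det e.toBasis θ v
  have h2 := ContinuousAlternatingMap.eq_apply_basis_mul_det e.toBasis η v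
  simp only [OrthonormalBasis.coe_toBasis, he, one_mul] at h1 h2
  rw [h1, h2]

theorem IsUnitVolume.apply_orthonormalBasis_sq {n : ℕ} {θ : V [⋀^Fin n]→L[ℝ] ℝ}
    (hθ : IsUnitVolume θ) (e : OrthonormalBasis (Fin n) ℝ V) : θ e ^ 2 = 1 := by
  rw [hθ, Matrix.det_gram_of_orthogonal _ fun i j hij => e.orthonormal.2 hij]
  simp

variable [FiniteDimensional ℝ V]

/-- This frees the Frobenius norm from the basis chosen in its definition. Each `‖A (e l)‖ ^ 2` is
expanded in the chosen basis `f`; summing over `l`, Parseval's identity for `e` collapses the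
coefficients to the Kronecker delta. -/
theorem frobeniusNorm_sq {n : ℕ} (A : V →L[ℝ] W) (e : OrthonormalBasis (Fin n) ℝ V) :
    frobeniusNorm A ^ 2 = ∑ i, ‖A (e i)‖ ^ 2 := by
  rw [frobeniusNorm, Real.sq_sqrt (Finset.sum_nonneg fun _ _ => by positivity)]
  set f := stdOrthonormalBasis ℝ V
  have aux : ∀ (v : V), ‖A v‖ ^ 2 =
      ∑ i, ∑ j, inner ℝ (f i) v * inner ℝ (f j) v * inner ℝ (A (f i)) (A (f j)) := by
    intro v
    conv_lhs => rw [← f.sum_repr' v]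
    rw [← real_inner_self_eq_norm_sq, map_sum, sum_inner]
    refine Finset.sum_congr rfl fun i _ => ?_
    rw [inner_sum]
    refine Finset.sum_congr rfl fun j _ => ?_
    rw [map_smul, map_smul, real_inner_smul_left, real_inner_smul_right]
    ring
  simp_rw [aux (e _)]
  rw [Finset.sum_comm]
  refine Finset.sum_congr rfl fun i _ => ?_
  rw [Finset.sum_comm]
  simp_rw [← Finset.sum_mul]
  have : ∀ j, ∑ l, inner ℝ (f i) (e l) * inner ℝ (f j) (e l) = if i = j then 1 else 0 := by
    intro j
    have := e.sum_inner_mul_inner (f i) (f j)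
    rw [orthonormal_iff_ite.1 f.orthonormal i j] at this
    rw [← this]
    exact Finset.sum_congr rfl fun l _ => by rw [real_inner_comm (f j)]
  simp [this]

/-- The characterizing property of the star: `θ` is linear in its last slot, so expanding `w` in the
chosen orthonormal basis suffices. Later arguments use this in place of the definition. -/
theorem inner_hodgeStar {k : ℕ} (θ : V [⋀^Fin (k + 1)]→L[ℝ] ℝ) (v : Fin k → V) (w : V) :
    inner ℝ (hodgeStar θ v) w = θ (Fin.snoc v w) := by
  set f := stdOrthonormalBasis ℝ V
  have hlin : ∀ w, θ (Fin.snoc v w) =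
      θ.toMultilinearMap.toLinearMap (Fin.snoc v 0) (Fin.last k) w := by
    intro w
    rw [MultilinearMap.toLinearMap_apply, Fin.update_snoc_last]
    rfl
  rw [hlin w]
  conv_rhs => rw [← f.sum_repr' w, map_sum]
  rw [hodgeStar, sum_inner]
  refine Finset.sum_congr rfl fun i _ => ?_
  rw [real_inner_smul_left, map_smul, smul_eq_mul, mul_comm, ← hlin]

/-- An oriented singular value decomposition: eigenvectors of `A^*A` are orthonormal and have
orthogonal images under `A`. -/
theorem ContinuousLinearMap.exists_orthonormalBasis_orthogonal [FiniteDimensional ℝ W] {k : ℕ}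
    (hV : Module.finrank ℝ V = k + 1) {θ : V [⋀^Fin (k + 1)]→L[ℝ] ℝ} (hθ : IsUnitVolume θ)
    (A : V →L[ℝ] W) : ∃ e : OrthonormalBasis (Fin (k + 1)) ℝ V, θ e = 1 ∧
      ∀ i j, i ≠ j → inner ℝ (A (e i)) (A (e j)) = 0 := by
  let T : V →ₗ[ℝ] V := LinearMap.adjoint A.toLinearMap ∘ₗ A.toLinearMap
  have hT : T.IsSymmetric := fun v w => by
    simp [T, LinearMap.adjoint_inner_left, LinearMap.adjoint_inner_right]
  let e := hT.eigenvectorBasis hV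
  have he : ∀ i j, i ≠ j → inner ℝ (A (e i)) (A (e j)) = 0 := by
    intro i j hij
    have h1 : inner ℝ (A (e i)) (A (e j)) = inner ℝ (T (e i)) (e j) := by
      simp [T, LinearMap.adjoint_inner_left]
    rw [h1, hT.apply_eigenvectorBasis hV i, inner_smul_left, e.orthonormal.2 hij, mul_zero]
  rcases mul_self_eq_one_iff.1 ((sq _).symm.trans (hθ.apply_orthonormalBasis_sq e)) with h | h
  · exact ⟨e, h, he⟩
  -- If the eigenbasis is negatively oriented, reversing its vector of index `0` corrects the
  -- orientation and preserves all orthogonality relations.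
  · let ε : Fin (k + 1) → ℝ := Function.update 1 0 (-1)
    have hε : ∀ i, ε i = 1 ∨ ε i = -1 := fun i => by
      by_cases hi : i = 0
      · subst hi; right; simp [ε]
      · left; simp [ε, hi]
    let f : Fin (k + 1) → V := fun i => ε i • e i
    have hf : Orthonormal ℝ f := by
      refine ⟨fun i => ?_, fun i j hij => ?_⟩
      · rcases hε i with h | h <;> simp [f, h]
      · simp only [f, inner_smul_left, inner_smul_right, e.orthonormal.2 hij, mul_zero]
    let e' : OrthonormalBasis (Fin (k + 1)) ℝ V :=
      OrthonormalBasis.mk hf (hf.linearIndependent.span_eq_top_of_card_eq_finrank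
        (by simp [hV])).ge
    have he' : (e' : Fin (k + 1) → V) = f := OrthonormalBasis.coe_mk _ _
    refine ⟨e', ?_, ?_⟩
    · rw [he']
      have := θ.toMultilinearMap.map_smul_univ ε (fun i => e i)
      have h2 : ∏ i, ε i = -1 := by
        rw [Finset.prod_update_of_mem (Finset.mem_univ _)]; simp
      rw [h2] at this
      refine this.trans ?_
      change -1 • θ e = 1
      rw [h]; norm_num
    · intro i j hij
      rw [he']
      simp [f, inner_smul_left, inner_smul_right, he i j hij]

/-- The vector `*v` is orthogonal to all `v i`, so applying the unit-volume identity to `(v, *v)`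
gives `|*v|⁴ = det(gram v) |*v|²`, and `|*v|²` cancels when nonzero. If `*v = 0`, a nonzero `w`
orthogonal to the `k` vectors `v i`, which exists by dimension, takes the place of `*v` and shows
that the Gram determinant vanishes. -/
theorem IsUnitVolume.norm_hodgeStar_sq {k : ℕ} (hV : Module.finrank ℝ V = k + 1)
    {θ : V [⋀^Fin (k + 1)]→L[ℝ] ℝ} (hθ : IsUnitVolume θ) (v : Fin k → V) :
    ‖hodgeStar θ v‖ ^ 2 = (Matrix.gram ℝ v).det := by
  have horth : ∀ i, inner ℝ (v i) (hodgeStar θ v) = 0 := by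
    intro i
    rw [real_inner_comm, inner_hodgeStar]
    refine θ.map_eq_zero_of_eq _ (i := i.castSucc) (j := Fin.last k) ?_ (Fin.castSucc_lt_last i).ne
    simp
  have h1 : ‖hodgeStar θ v‖ ^ 2 = θ (Fin.snoc v (hodgeStar θ v)) := by
    rw [← inner_hodgeStar, real_inner_self_eq_norm_sq]
  have h2 := hθ (Fin.snoc v (hodgeStar θ v))
  rw [Matrix.det_gram_snoc_of_orthogonal _ _ horth, ← h1] at h2
  by_cases h0 : hodgeStar θ v = 0
  · obtain ⟨w, hw, hw0⟩ : ∃ w ∈ (Submodule.span ℝ (Set.range v))ᗮ, w ≠ 0 := by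
      refine Submodule.exists_mem_ne_zero_of_ne_bot fun hbot => ?_
      have h3 := Submodule.finrank_add_finrank_orthogonal (Submodule.span ℝ (Set.range v))
      have h4 : Module.finrank ℝ (Submodule.span ℝ (Set.range v)) ≤ k := by
        simpa [Set.finrank] using finrank_range_le_card (R := ℝ) v
      rw [hbot, finrank_bot] at h3
      omega
    have hw' : ∀ i, inner ℝ (v i) w = 0 := fun i =>
      (Submodule.mem_orthogonal _ _).1 hw _ (Submodule.subset_span (Set.mem_range_self i))
    have h5 := hθ (Fin.snoc v w)
    rw [Matrix.det_gram_snoc_of_orthogonal _ _ hw', ← inner_hodgeStar, h0, inner_zero_left] at h5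
    have h6 : ‖w‖ ^ 2 ≠ 0 := by simpa using hw0
    have : (Matrix.gram ℝ v).det = 0 := by
      by_contra hne
      exact mul_ne_zero hne h6 (by rw [← h5]; norm_num)
    rw [this, h0]; simp
  · have h3 : ‖hodgeStar θ v‖ ^ 2 ≠ 0 := by simpa using h0
    rw [sq (‖hodgeStar θ v‖ ^ 2)] at h2
    exact mul_right_cancel₀ h3 h2

/-- The pointwise inequality `A^*α ≤ |A|ⁿ vol / (√n)ⁿ` on an oriented orthonormal basis, with
equality exactly for linear Smith maps. -/
theorem IsVectorCrossProduct.calibration_le [FiniteDimensional ℝ W] {k : ℕ} (hk : 1 ≤ k)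
    (hV : Module.finrank ℝ V = k + 1) {θ : V [⋀^Fin (k + 1)]→L[ℝ] ℝ} (hθ : IsUnitVolume θ)
    {Q : W [⋀^Fin k]→L[ℝ] W} (hQ : IsVectorCrossProduct Q) {α : W [⋀^Fin (k + 1)]→L[ℝ] ℝ}
    (hα : ∀ (v : Fin k → W) (w : W), α (Fin.snoc v w) = inner ℝ (Q v) w) (A : V →L[ℝ] W) :
    ∃ e : OrthonormalBasis (Fin (k + 1)) ℝ V, θ e = 1 ∧
      α (fun i => A (e i)) ≤
        1 / √((k + 1 : ℕ) : ℝ) ^ (k + 1) * frobeniusNorm A ^ (k + 1) ∧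
      (α (fun i => A (e i)) =
        1 / √((k + 1 : ℕ) : ℝ) ^ (k + 1) * frobeniusNorm A ^ (k + 1) ↔ IsLinearSmithMap θ Q A) := by
  obtain ⟨e, he, hAe⟩ := A.exists_orthonormalBasis_orthogonal hV hθ
  refine ⟨e, he, ?_⟩
  set C := 1 / √((k + 1 : ℕ) : ℝ) ^ (k + 1) * frobeniusNorm A ^ (k + 1) with hC
  have hC0 : 0 ≤ C := by
    have : 0 ≤ frobeniusNorm A := Real.sqrt_nonneg _
    positivity
  have hC2 : C ^ 2 = ((∑ i, ‖A (e i)‖ ^ 2) / (k + 1 : ℕ)) ^ (k + 1) := by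
    rw [← frobeniusNorm_sq A e, hC, mul_pow, div_pow, one_pow, ← pow_mul, ← pow_mul, div_pow,
      mul_comm (k + 1) 2, pow_mul, pow_mul, Real.sq_sqrt (by positivity), ← pow_mul]
    ring
  have hsplit : ∀ f : Fin (k + 1) → V, (fun i => A (f i)) =
      (Fin.snoc (fun i : Fin k => A (f i.castSucc)) (A (f (Fin.last k))) : Fin (k + 1) → W) := by
    intro f
    ext i
    refine Fin.lastCases ?_ (fun j => ?_) i <;> simp
  set a := α (fun i => A (e i)) with ha
  have hpull : ∀ v : Fin (k + 1) → V, α (fun i => A (v i)) = a * θ v := fun v =>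
    IsUnitVolume.apply_eq (η := α.compContinuousLinearMap A) he v
  have hQnorm : ‖Q (fun i : Fin k => A (e i.castSucc))‖ ^ 2 =
      ∏ i : Fin k, ‖A (e i.castSucc)‖ ^ 2 := by
    rw [hQ.norm_sq, Matrix.det_gram_of_orthogonal]
    exact fun i j hij => hAe _ _ (Fin.castSucc_injective k |>.ne hij)
  -- Cauchy–Schwarz for `⟪Q(A e₁, …, A e_k), A e_(k+1)⟫`, followed by the norm identity for `Q`,
  -- whose Gram matrix is diagonal here.
  have ha2 : a ^ 2 ≤ ∏ i, ‖A (e i)‖ ^ 2 := by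
    rw [ha, hsplit e, hα, Fin.prod_univ_castSucc, ← hQnorm, ← mul_pow]
    exact sq_le_sq' (neg_le_of_abs_le (abs_real_inner_le_norm _ _)) (real_inner_le_norm _ _)
  have hamgm := prod_le_sum_div_pow k.succ_ne_zero (fun i => ‖A (e i)‖ ^ 2) fun i => by positivity
  have hle : a ≤ C := by
    refine le_of_sq_le_sq ?_ hC0
    rw [hC2]; exact ha2.trans hamgm.1
  have hsnocA : ∀ (v : Fin k → V) (w : V), (fun i => A ((Fin.snoc v w : Fin (k + 1) → V) i)) =
      (Fin.snoc (fun i => A (v i)) (A w) : Fin (k + 1) → W) := by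
    intro v w
    ext i
    refine Fin.lastCases ?_ (fun j => ?_) i <;> simp
  have hstar : ∀ v : Fin k → V, inner ℝ (Q fun i => A (v i)) (A (hodgeStar θ v)) =
      a * ‖hodgeStar θ v‖ ^ 2 := by
    intro v
    rw [← hα, ← hsnocA, hpull, ← inner_hodgeStar, real_inner_self_eq_norm_sq]
  refine ⟨hle, fun haC => ?_, ?_⟩
  · -- equality forces a conformal map
    have hprod : ∏ i, ‖A (e i)‖ ^ 2 = ((∑ i, ‖A (e i)‖ ^ 2) / (k + 1 : ℕ)) ^ (k + 1) :=
      le_antisymm hamgm.1 (by rw [← hC2, ← haC]; exact ha2)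
    have hz := hamgm.2 hprod
    obtain ⟨lam, hlam0, hlam⟩ : ∃ lam : ℝ, 0 ≤ lam ∧ ∀ i, ‖A (e i)‖ = lam := by
      refine ⟨√((∑ i, ‖A (e i)‖ ^ 2) / (k + 1 : ℕ)), Real.sqrt_nonneg _, fun i => ?_⟩
      rw [← hz i, Real.sqrt_sq (norm_nonneg _)]
    have haval : a = lam ^ (k + 1) := by
      rw [haC]
      refine (sq_eq_sq₀ hC0 (by positivity)).1 ?_
      rw [hC2, ← hprod]
      simp [hlam, ← pow_mul, mul_comm]
    have hinner : ∀ v w, inner ℝ (A v) (A w) = lam ^ 2 * inner ℝ v w := by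
      intro v w
      rw [← e.sum_inner_mul_inner v w]
      conv_lhs => rw [← e.sum_repr' v, ← e.sum_repr' w]
      rw [map_sum, map_sum, sum_inner, Finset.mul_sum]
      refine Finset.sum_congr rfl fun i _ => ?_
      rw [inner_sum, Finset.sum_eq_single i]
      · rw [map_smul, map_smul, real_inner_smul_left, real_inner_smul_right,
          real_inner_self_eq_norm_sq, hlam, real_inner_comm v]
        ring
      · intro j _ hj
        rw [map_smul, map_smul, real_inner_smul_left, real_inner_smul_right, hAe i j hj.symm]
        ring
      · simp
    have hgram : ∀ v : Fin k → V, (Matrix.gram ℝ fun i => A (v i)).det =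
        lam ^ (2 * k) * (Matrix.gram ℝ v).det := by
      intro v
      have : (Matrix.gram ℝ fun i => A (v i)) = lam ^ 2 • Matrix.gram ℝ v := by
        ext i j
        simp [Matrix.gram_apply, hinner]
      rw [this, Matrix.det_smul, ← pow_mul, Fintype.card_fin]
    -- Expand `|Q(Av) - lam^(k-1) A(*v)|²`. With `a = lam^(k+1)` and `A` conformal of factor `lam`,
    -- both squared norms and the inner product all equal `lam^(2k) det(gram v)`, so the square
    -- vanishes.
    have hSmith : ∀ v : Fin k → V, Q (fun i => A (v i)) = lam ^ (k - 1) • A (hodgeStar θ v) := by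
      intro v
      rw [← sub_eq_zero, ← norm_eq_zero, ← sq_eq_zero_iff, norm_sub_sq_real, hQ.norm_sq, hgram,
        real_inner_smul_right, hstar, norm_smul, mul_pow, ← real_inner_self_eq_norm_sq (A _),
        hinner, real_inner_self_eq_norm_sq, hθ.norm_hodgeStar_sq hV, haval]
      obtain ⟨l, rfl⟩ := Nat.exists_eq_add_of_le hk
      simp only [Nat.add_sub_cancel_left, Real.norm_eq_abs, abs_of_nonneg (pow_nonneg hlam0 _)]
      ring
    -- The factor in the Smith equation must be positive. If `lam = 0` then `A = 0`, and any
    -- positive factor serves.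
    rcases hlam0.lt_or_eq with h | h
    · exact ⟨lam, h, hSmith⟩
    · have hA : ∀ v, A v = 0 := fun v => by
        have := hinner v v
        rw [← h] at this
        simpa using this
      refine ⟨1, one_pos, fun v => ?_⟩
      rw [hA, smul_zero]
      refine Q.map_coord_zero (⟨0, hk⟩ : Fin k) (hA _)
  · rintro ⟨c, hc, hS⟩
    -- Move `e i` to the last slot by a transposition `σ`. The star of the remaining vectors is `± e
    -- i`, and pairing the Smith equation with its image under `A` squares the sign away. Since the
    -- left side does not depend on `i`, all the `A (e i)` have the same length.
    have hAi : ∀ i, a = c ^ (k - 1) * ‖A (e i)‖ ^ 2 := by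
      intro i
      let σ : Equiv.Perm (Fin (k + 1)) := Equiv.swap i (Fin.last k)
      have hθσ : θ (e ∘ σ) ^ 2 = 1 := by
        have := hθ.apply_orthonormalBasis_sq (e.reindex σ.symm)
        simpa using this
      have hst : hodgeStar θ (fun j : Fin k => e (σ j.castSucc)) = θ (e ∘ σ) • e i := by
        refine InnerProductSpace.ext_inner_right_basis (e.reindex σ.symm).toBasis fun j => ?_
        simp only [OrthonormalBasis.coe_toBasis, OrthonormalBasis.reindex_apply, Equiv.symm_symm]
        rw [inner_hodgeStar, real_inner_smul_left]
        refine Fin.lastCases ?_ (fun l => ?_) j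
        · have : (Fin.snoc (fun j : Fin k => e (σ j.castSucc)) (e (σ (Fin.last k))) :
              Fin (k + 1) → V) = e ∘ σ := by
            ext i
            refine Fin.lastCases ?_ (fun j => ?_) i <;> simp
          rw [this]
          simp [σ]
        · have h1 : inner ℝ (e i) (e (σ l.castSucc)) = 0 := by
            refine e.orthonormal.2 fun h => ?_
            have : σ (Fin.last k) = σ l.castSucc := by rw [← h]; simp [σ]
            exact (Fin.castSucc_lt_last l).ne (σ.injective this).symm
          rw [h1, mul_zero]
          refine θ.map_eq_zero_of_eq _ (i := l.castSucc) (j := Fin.last k) ?_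
            (Fin.castSucc_lt_last l).ne
          simp
      have h1 := hstar (fun j : Fin k => e (σ j.castSucc))
      rw [hS, hst, real_inner_smul_left, real_inner_self_eq_norm_sq, map_smul, norm_smul,
        norm_smul, mul_pow, mul_pow, Real.norm_eq_abs, sq_abs, hθσ] at h1
      simpa using h1.symm
    have hμ : ∀ i, ‖A (e i)‖ = ‖A (e 0)‖ := by
      intro i
      have h := (hAi i).symm.trans (hAi 0)
      have := mul_left_cancel₀ (pow_ne_zero _ hc.ne') h
      exact (sq_eq_sq₀ (norm_nonneg _) (norm_nonneg _)).1 this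
    set μ := ‖A (e 0)‖ with hμdef
    have hμ0 : 0 ≤ μ := norm_nonneg _
    have hCμ : C = μ ^ (k + 1) := by
      refine (sq_eq_sq₀ hC0 (by positivity)).1 ?_
      have : ((k + 1 : ℕ) : ℝ) ≠ 0 := by positivity
      rw [hC2]
      simp only [hμ, Finset.sum_const, Finset.card_univ, Fintype.card_fin, nsmul_eq_mul]
      rw [mul_div_cancel_left₀ _ this, ← pow_mul, ← pow_mul, mul_comm]
    -- Taking norms in the Smith equation on the first `k` basis vectors gives `c^(k-1) μ = μ^k`.
    -- Together with `a = c^(k-1) μ²` this yields `a = μ^(k+1) = C`; the case `μ = 0` is separate.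
    have h1 := hQnorm
    have hstar0 : ‖A (hodgeStar θ (fun j : Fin k => e j.castSucc))‖ = μ := by
      have : hodgeStar θ (fun j : Fin k => e j.castSucc) = e (Fin.last k) := by
        refine InnerProductSpace.ext_inner_right_basis e.toBasis fun j => ?_
        simp only [OrthonormalBasis.coe_toBasis]
        rw [inner_hodgeStar]
        refine Fin.lastCases ?_ (fun l => ?_) j
        · have : (Fin.snoc (fun j : Fin k => e j.castSucc) (e (Fin.last k)) :
              Fin (k + 1) → V) = e := by
            ext i
            refine Fin.lastCases ?_ (fun j => ?_) i <;> simp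
          rw [this, he]
          simp
        · rw [e.orthonormal.2 (Fin.castSucc_lt_last l).ne']
          refine θ.map_eq_zero_of_eq _ (i := l.castSucc) (j := Fin.last k) ?_
            (Fin.castSucc_lt_last l).ne
          simp
      rw [this, hμ]
    rw [hS, norm_smul, hstar0] at h1
    simp only [hμ, Finset.prod_const, Finset.card_univ, Fintype.card_fin, Real.norm_eq_abs,
      abs_of_pos (pow_pos hc (k - 1)), ← pow_mul] at h1
    rw [hCμ, hAi 0, ← hμdef]
    obtain ⟨l, rfl⟩ := Nat.exists_eq_add_of_le hk
    simp only [Nat.add_sub_cancel_left] at h1 ⊢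
    rcases hμ0.lt_or_eq with h | h
    · have h2 : c ^ l * μ = μ ^ (l + 1) := by
        refine (sq_eq_sq₀ (by positivity) (by positivity)).1 ?_
        rw [h1]; ring
      rw [sq, ← mul_assoc, h2]; ring
    · simp [← h]

/-- For a frame `v`, the signed difference between `|A|ⁿ vol / (√n)ⁿ` and `A^*α`. -/
theorem IsVectorCrossProduct.sign_mul_energy_sub [FiniteDimensional ℝ W] {k : ℕ} (hk : 1 ≤ k)
    (hV : Module.finrank ℝ V = k + 1) {θ : V [⋀^Fin (k + 1)]→L[ℝ] ℝ} (hθ : IsUnitVolume θ)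
    {Q : W [⋀^Fin k]→L[ℝ] W} (hQ : IsVectorCrossProduct Q) {α : W [⋀^Fin (k + 1)]→L[ℝ] ℝ}
    (hα : ∀ (v : Fin k → W) (w : W), α (Fin.snoc v w) = inner ℝ (Q v) w) (A : V →L[ℝ] W)
    (v : Fin (k + 1) → V) :
    0 ≤ Real.sign (θ v) * (1 / √((k + 1 : ℕ) : ℝ) ^ (k + 1) * frobeniusNorm A ^ (k + 1) * θ v -
        α fun i => A (v i)) ∧
      (θ v ≠ 0 → (Real.sign (θ v) * (1 / √((k + 1 : ℕ) : ℝ) ^ (k + 1) *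
        frobeniusNorm A ^ (k + 1) * θ v - α fun i => A (v i)) = 0 ↔ IsLinearSmithMap θ Q A)) := by
  obtain ⟨e, he, hle, heq⟩ := hQ.calibration_le hk hV hθ hα A
  have hpull : α (fun i => A (v i)) = α (fun i => A (e i)) * θ v :=
    IsUnitVolume.apply_eq (η := α.compContinuousLinearMap A) he v
  have habs : Real.sign (θ v) * θ v = |θ v| := by
    rcases lt_trichotomy (θ v) 0 with h | h | h
    · rw [Real.sign_of_neg h, abs_of_neg h]; ring
    · simp [h]
    · rw [Real.sign_of_pos h, abs_of_pos h]; ring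
  rw [hpull, ← sub_mul, mul_left_comm, habs]
  refine ⟨mul_nonneg (sub_nonneg.2 hle) (abs_nonneg _), fun h0 => ?_⟩
  rw [mul_eq_zero, or_iff_left (abs_ne_zero.2 h0), sub_eq_zero, eq_comm, heq]

end LinearAlgebra

/-! ### Pullbacks of smooth forms -/

section Alternating

variable {E F G X : Type*} [NormedAddCommGroup E] [NormedSpace ℝ E] [NormedAddCommGroup F]
  [NormedSpace ℝ F] [NormedAddCommGroup G] [NormedSpace ℝ G] [NormedAddCommGroup X]
  [NormedSpace ℝ X] {k : ℕ}

/-- The antisymmetrization of continuous multilinear maps as a continuous linear map. -/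
def ContinuousMultilinearMap.alternatizationCLM :
    ContinuousMultilinearMap ℝ (fun _ : Fin k => E) G →L[ℝ] E [⋀^Fin k]→L[ℝ] G :=
  LinearMap.mkContinuous
    { toFun := fun f => ContinuousMultilinearMap.alternatization f
      map_add' := fun f g => map_add _ f g
      map_smul' := fun c f => by
        ext v
        simp [ContinuousMultilinearMap.alternatization_apply_apply, Finset.smul_sum,
          smul_comm c] }
    (k.factorial : ℝ) fun f => by
      refine ContinuousAlternatingMap.opNorm_le_bound _ (by positivity) fun v => ?_
      simp only [LinearMap.coe_mk, AddHom.coe_mk]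
      rw [ContinuousMultilinearMap.alternatization_apply_apply]
      refine (norm_sum_le _ _).trans ?_
      have : ∀ σ ∈ (Finset.univ : Finset (Equiv.Perm (Fin k))),
          ‖Equiv.Perm.sign σ • f (v ∘ σ)‖ ≤ ‖f‖ * ∏ i, ‖v i‖ := by
        intro σ _
        have h1 : ‖Equiv.Perm.sign σ • f (v ∘ σ)‖ = ‖f (v ∘ σ)‖ := by
          rcases Int.units_eq_one_or (Equiv.Perm.sign σ) with h | h <;> simp [h]
        rw [h1, ← Equiv.prod_comp σ fun i => ‖v i‖]
        exact f.le_opNorm _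
      refine (Finset.sum_le_sum this).trans_eq ?_
      simp [Fintype.card_perm, mul_assoc]

theorem ContinuousMultilinearMap.alternatizationCLM_coe (f : E [⋀^Fin k]→L[ℝ] G) :
    ContinuousMultilinearMap.alternatizationCLM f.toContinuousMultilinearMap =
      (k.factorial : ℝ) • f := by
  ext v
  change ContinuousMultilinearMap.alternatization f.toContinuousMultilinearMap v = _
  rw [ContinuousMultilinearMap.alternatization_apply_apply]
  have : ∀ σ : Equiv.Perm (Fin k),
      Equiv.Perm.sign σ • f.toContinuousMultilinearMap (v ∘ σ) = f v := by
    intro σ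
    have h := AlternatingMap.map_perm f.toAlternatingMap v σ
    change f (v ∘ σ) = _ • f v at h
    change Equiv.Perm.sign σ • f (v ∘ σ) = f v
    rw [h, smul_smul, Int.units_mul_self, one_smul]
  rw [Finset.sum_congr rfl fun σ _ => this σ]
  simp [Fintype.card_perm, Nat.cast_smul_eq_nsmul]

/-- Composition is smooth at the level of continuous multilinear maps. The operator `(1/k!) Alt` is
a continuous linear map back to alternating maps, and it fixes forms that are already alternating.
-/
theorem ContDiffWithinAt.continuousAlternatingMapCompContinuousLinearMap {n : WithTop ℕ∞}
    {η : X → F [⋀^Fin k]→L[ℝ] G} {A : X → E →L[ℝ] F} {s : Set X} {x : X}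
    (hη : ContDiffWithinAt ℝ n η s x) (hA : ContDiffWithinAt ℝ n A s x) :
    ContDiffWithinAt ℝ n (fun y => (η y).compContinuousLinearMap (A y)) s x := by
  have h1 : ContDiffWithinAt ℝ n (fun y =>
      (ContinuousMultilinearMap.compContinuousLinearMapContinuousMultilinear ℝ
        (fun _ : Fin k => E) (fun _ => F) G) (fun _ => A y)
        (η y).toContinuousMultilinearMap) s x := by
    refine ContDiffWithinAt.clm_apply ?_ ?_
    · refine ContDiffAt.comp_contDiffWithinAt x
        (ContinuousMultilinearMap.contDiff _).contDiffAt ?_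
      exact contDiffWithinAt_pi.2 fun _ => hA
    · exact (ContinuousAlternatingMap.toContinuousMultilinearMapCLM ℝ).contDiff.contDiffAt
        |>.comp_contDiffWithinAt x hη
  have h2 := ContDiffAt.comp_contDiffWithinAt x
    (((k.factorial : ℝ)⁻¹ • ContinuousMultilinearMap.alternatizationCLM (E := E) (G := G)
      (k := k)).contDiff.contDiffAt) h1
  have h3 : ∀ y, (η y).compContinuousLinearMap (A y) = ((k.factorial : ℝ)⁻¹ •
      ContinuousMultilinearMap.alternatizationCLM (E := E) (G := G) (k := k))
      ((η y).compContinuousLinearMap (A y)).toContinuousMultilinearMap := by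
    intro y
    rw [_root_.smul_apply, ContinuousMultilinearMap.alternatizationCLM_coe,
      inv_smul_smul₀ (by positivity)]
  exact h2.congr_of_eventuallyEq (Filter.Eventually.of_forall h3) (h3 x)

theorem ContinuousAlternatingMap.eq_zero_of_finrank_lt [FiniteDimensional ℝ E]
    (h : Module.finrank ℝ E < k) (f : E [⋀^Fin k]→L[ℝ] G) : f = 0 := by
  ext v
  refine AlternatingMap.map_linearDependent f.toAlternatingMap v fun hv => ?_
  have := hv.fintype_card_le_finrank
  simp at this
  omega

end Alternating

/-! ### Pullbacks and the exterior derivative in charts. -/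

section Forms

variable {E : Type*} [NormedAddCommGroup E] [NormedSpace ℝ E]
  {H : Type*} [TopologicalSpace H] {I : ModelWithCorners ℝ E H}
  {M : Type*} [TopologicalSpace M] [ChartedSpace H M]
  {E' : Type*} [NormedAddCommGroup E'] [NormedSpace ℝ E']
  {H' : Type*} [TopologicalSpace H'] {J : ModelWithCorners ℝ E' H'}
  {N : Type*} [TopologicalSpace N] [ChartedSpace H' N] {k : ℕ}

/-- The pullback of a form by a map from a subset of a normed space. -/
def DiffForm.pullbackWithin (θ : DiffForm I M k) (f : E' → M) (s : Set E') (y : E') :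
    E' [⋀^Fin k]→L[ℝ] ℝ :=
  (θ (f y)).compContinuousLinearMap (mfderivWithin 𝓘(ℝ, E') I f s y)

theorem DiffForm.inChart_extChartAt_apply [IsManifold I 1 M] (θ : DiffForm I M k) (q z : M)
    (hz : z ∈ (extChartAt I q).source) (v : Fin k → E) :
    θ.inChart q (extChartAt I q z) v = θ z fun i =>
      mfderivWithin 𝓘(ℝ, E) I (extChartAt I q).symm (Set.range I) (extChartAt I q z) (v i) := by
  -- The fibre containing `θ w` depends on `w`. Viewing all fibres as forms on the model space `E`
  -- allows the base point to be replaced.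
  have aux : ∀ w, w = z → ∀ v : Fin k → E, (θ w : E [⋀^Fin k]→L[ℝ] ℝ) v =
    (θ z : E [⋀^Fin k]→L[ℝ] ℝ) v := by rintro w rfl v; rfl
  exact aux _ ((extChartAt I q).left_inv hz) _

theorem fderivWithin_extChartAt_comp [IsManifold I 1 M] {f : E' → M} {s : Set E'} {y : E'} (q : M)
    (hf : MDifferentiableWithinAt 𝓘(ℝ, E') I f s y) (hs : UniqueDiffWithinAt ℝ s y)
    (hq : f y ∈ (extChartAt I q).source) :
    fderivWithin ℝ (extChartAt I q ∘ f) s y =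
      (mfderiv I 𝓘(ℝ, E) (extChartAt I q) (f y)).comp (mfderivWithin 𝓘(ℝ, E') I f s y) := by
  rw [extChartAt_source] at hq
  rw [← mfderivWithin_eq_fderivWithin]
  exact mfderiv_comp_mfderivWithin y (mdifferentiableAt_extChartAt hq) hf
    (uniqueMDiffWithinAt_iff_uniqueDiffWithinAt.2 hs)

/-- The derivatives of the chart and of its inverse cancel on the tangent space. This reduces
pullbacks to manifolds to pullbacks between normed spaces, near any point that `f` sends into the
chart domain. -/
theorem DiffForm.pullbackWithin_eq [IsManifold I 1 M] (θ : DiffForm I M k) {f : E' → M} {s : Set E'} {y : E'} (q : M)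
    (hf : MDifferentiableWithinAt 𝓘(ℝ, E') I f s y) (hs : UniqueDiffWithinAt ℝ s y)
    (hq : f y ∈ (extChartAt I q).source) :
    θ.pullbackWithin f s y = (θ.inChart q (extChartAt I q (f y))).compContinuousLinearMap
      (fderivWithin ℝ (extChartAt I q ∘ f) s y) := by
  ext v
  have h1 := fderivWithin_extChartAt_comp (I := I) q hf hs hq
  have h2 := mfderivWithin_extChartAt_symm_comp_mfderiv_extChartAt' (I := I) hq
  change θ (f y) (fun i => mfderivWithin 𝓘(ℝ, E') I f s y (v i)) =
    θ.inChart q (extChartAt I q (f y)) (fun i => fderivWithin ℝ (extChartAt I q ∘ f) s y (v i))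
  rw [DiffForm.inChart_extChartAt_apply θ q (f y) hq]
  congr 1
  funext i
  rw [h1]
  exact (congrArg (fun L => L (mfderivWithin 𝓘(ℝ, E') I f s y (v i))) h2).symm


theorem DiffForm.contDiffOn_pullbackWithin [IsManifold I ∞ M] {θ : DiffForm I M k}
    (hθ : θ ∈ smoothForms I M k) {f : E' → M} {s : Set E'}
    (hf : ContMDiffOn 𝓘(ℝ, E') I ∞ f s) (hs : UniqueDiffOn ℝ s) :
    ContDiffOn ℝ ∞ (θ.pullbackWithin f s) s := by
  intro y hy
  set q := f y
  have hnhds : f ⁻¹' (extChartAt I q).source ∈ nhdsWithin y s :=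
    (hf y hy).continuousWithinAt.preimage_mem_nhdsWithin (extChartAt_source_mem_nhds q)
  have hev : ∀ z ∈ f ⁻¹' (extChartAt I q).source ∩ s, θ.pullbackWithin f s z =
      (θ.inChart q (extChartAt I q (f z))).compContinuousLinearMap
        (fderivWithin ℝ (extChartAt I q ∘ f) s z) := fun z hz =>
    θ.pullbackWithin_eq q ((hf z hz.2).mdifferentiableWithinAt (by simp)) (hs z hz.2) hz.1
  have hg : ContDiffWithinAt ℝ ∞ (extChartAt I q ∘ f) s y := by
    rw [← contMDiffWithinAt_iff_contDiffWithinAt]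
    exact (contMDiffAt_extChartAt (I := I) (x := q)).comp_contMDiffWithinAt y (hf y hy)
  have h1 : ContDiffWithinAt ℝ ∞ (fun z => θ.inChart q (extChartAt I q (f z))) s y := by
    have h2 : ContDiffWithinAt ℝ ∞ (θ.inChart q) (extChartAt I q).target (extChartAt I q (f y)) :=
      hθ q _ (mem_extChartAt_target q)
    refine (h2.comp (s := s ∩ f ⁻¹' (extChartAt I q).source) y (hg.mono Set.inter_subset_left)
      fun z hz => (extChartAt I q).map_source hz.2).mono_of_mem_nhdsWithin ?_
    exact Filter.inter_mem self_mem_nhdsWithin hnhds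
  have h3 : ContDiffWithinAt ℝ ∞ (fderivWithin ℝ (extChartAt I q ∘ f) s) s y :=
    hg.fderivWithin_right hs (by simp) hy
  refine (h1.continuousAlternatingMapCompContinuousLinearMap h3).congr_of_eventuallyEq ?_ ?_
  · filter_upwards [hnhds, self_mem_nhdsWithin] with z hz hzs using hev z ⟨hz, hzs⟩
  · exact hev y ⟨mem_extChartAt_source q, hy⟩

/-- The chart target is a neighbourhood of `y` relative to the model range, also at boundary points,
so the two sets give the same derivative. -/
theorem mfderivWithin_extChartAt_target_eq (f : E' → M) {p : N} {y : E'}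
    (hy : y ∈ (extChartAt J p).target) :
    mfderivWithin 𝓘(ℝ, E') I f (extChartAt J p).target y =
      mfderivWithin 𝓘(ℝ, E') I f (Set.range J) y := by
  refine mfderivWithin_congr_set (Filter.eventuallyEq_set.2 ?_)
  have := extChartAt_target_mem_nhdsWithin_of_mem (I := J) hy
  rw [mem_nhdsWithin_iff_eventually] at this
  filter_upwards [this] with z hz
  exact ⟨fun h => extChartAt_target_subset_range p h, hz⟩

theorem DiffForm.inChart_pullback [IsManifold J 1 N] (u : C^∞⟮J, N; I, M⟯)
    (θ : DiffForm I M k) (p : N) {y : E'} (hy : y ∈ (extChartAt J p).target) :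
    (DiffForm.pullback u θ).inChart p y =
      θ.pullbackWithin (u ∘ (extChartAt J p).symm) (extChartAt J p).target y := by
  ext v
  have h1 : mfderivWithin 𝓘(ℝ, E') I (u ∘ (extChartAt J p).symm) (extChartAt J p).target y =
      (mfderiv J I u ((extChartAt J p).symm y)).comp
        (mfderivWithin 𝓘(ℝ, E') J (extChartAt J p).symm (Set.range J) y) := by
    rw [mfderivWithin_extChartAt_target_eq _ hy]
    exact mfderiv_comp_mfderivWithin y (u.contMDiff.mdifferentiableAt (by simp))
      (mdifferentiableWithinAt_extChartAt_symm hy)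
      (J.uniqueMDiffOn _ (extChartAt_target_subset_range p hy))
  change θ _ _ = θ _ _
  congr 1
  funext i
  exact (congrArg (fun L : E' →L[ℝ] E => L (v i)) h1).symm

theorem DiffForm.pullback_mem_smoothForms [IsManifold I ∞ M] [IsManifold J ∞ N]
    (u : C^∞⟮J, N; I, M⟯) {θ : DiffForm I M k} (hθ : θ ∈ smoothForms I M k) :
    DiffForm.pullback u θ ∈ smoothForms J N k := by
  intro p
  refine (DiffForm.contDiffOn_pullbackWithin hθ
    (u.contMDiff.comp_contMDiffOn (contMDiffOn_extChartAt_symm p))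
    (uniqueDiffOn_extChartAt_target p)).congr fun y hy => DiffForm.inChart_pullback u θ p hy

/-- The exterior derivative commutes with pullback by smooth maps. -/
theorem DiffForm.extDeriv_pullbackWithin [IsManifold I ∞ M] (θ : smoothForms I M k) {f : E' → M}
    {s : Set E'} (hs : IsOpen s) (hf : ContMDiffOn 𝓘(ℝ, E') I ∞ f s) {y : E'} (hy : y ∈ s) :
    extDerivWithin (DiffForm.pullbackWithin θ.1 f s) s y = (extD I M k θ).pullbackWithin f s y := by
  set q := f y
  have hnhds : f ⁻¹' (extChartAt I q).source ∈ nhdsWithin y s :=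
    (hf y hy).continuousWithinAt.preimage_mem_nhdsWithin (extChartAt_source_mem_nhds q)
  have hg : ContDiffWithinAt ℝ ∞ (extChartAt I q ∘ f) s y := by
    rw [← contMDiffWithinAt_iff_contDiffWithinAt]
    exact (contMDiffAt_extChartAt (I := I) (x := q)).comp_contMDiffWithinAt y (hf y hy)
  have hev : ∀ z ∈ f ⁻¹' (extChartAt I q).source ∩ s, DiffForm.pullbackWithin θ.1 f s z =
      (θ.1.inChart q ((extChartAt I q ∘ f) z)).compContinuousLinearMap
        (fderivWithin ℝ (extChartAt I q ∘ f) s z) := fun z hz =>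
    θ.1.pullbackWithin_eq q ((hf z hz.2).mdifferentiableWithinAt (by simp))
      (hs.uniqueDiffOn z hz.2) hz.1
  have hev' : DiffForm.pullbackWithin θ.1 f s =ᶠ[nhdsWithin y s] fun z =>
      (θ.1.inChart q ((extChartAt I q ∘ f) z)).compContinuousLinearMap
        (fderivWithin ℝ (extChartAt I q ∘ f) s z) := by
    filter_upwards [hnhds, self_mem_nhdsWithin] with z hz hzs using hev z ⟨hz, hzs⟩
  rw [hev'.extDerivWithin_eq (hev y ⟨mem_extChartAt_source q, hy⟩),
    extDerivWithin_pullback (r := ∞) (t := Set.range I) (f := extChartAt I q ∘ f)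
      (smoothForms.differentiableWithinAt θ q) hg
      (by rw [minSmoothness_of_isRCLikeNormedField]; exact WithTop.coe_le_coe.2 (le_top : (2 : ℕ∞) ≤ ⊤)) hs.uniqueDiffOn
      (by rw [hs.interior_eq]; exact subset_closure hy) hy
      (fun z _ => by simp [extChartAt])]
  -- The chart was taken at `q = f y`, exactly the chart in which `extD` is defined at `f y`, so no
  -- comparison of charts is needed.
  rw [fderivWithin_extChartAt_comp q ((hf y hy).mdifferentiableWithinAt (by simp))
    (hs.uniqueDiffOn y hy) (mem_extChartAt_source q)]
  rfl

theorem DiffForm.smul_mem_smoothForms [IsManifold I ∞ M] (χ : C^∞⟮I, M; 𝓘(ℝ, ℝ), ℝ⟯)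
    {θ : DiffForm I M k} (hθ : θ ∈ smoothForms I M k) :
    (fun x => χ x • θ x : DiffForm I M k) ∈ smoothForms I M k := by
  intro p
  have h1 : ContDiffOn ℝ ∞ (χ ∘ (extChartAt I p).symm) (extChartAt I p).target := by
    rw [← contMDiffOn_iff_contDiffOn]
    exact χ.contMDiff.comp_contMDiffOn (contMDiffOn_extChartAt_symm p)
  exact h1.smul (hθ p)

theorem extD_eq_zero_of_finrank_le [FiniteDimensional ℝ E] (h : Module.finrank ℝ E ≤ k)
    (θ : smoothForms I M k) : extD I M k θ = 0 := by
  funext x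
  exact ContinuousAlternatingMap.eq_zero_of_finrank_lt (E := E) (by omega) _

end Forms

/-! ### Continuity of the energy density -/

section Frames

variable {V W : Type*} [NormedAddCommGroup V] [InnerProductSpace ℝ V]

theorem IsUnitVolume.apply_ne_zero {n : ℕ} {θ : V [⋀^Fin n]→L[ℝ] ℝ} (hθ : IsUnitVolume θ)
    {v : Fin n → V} (hv : LinearIndependent ℝ v) : θ v ≠ 0 := by
  have h := (Matrix.posDef_gram_of_linearIndependent hv).det_pos
  rw [← hθ v] at h
  exact fun h0 => by simp [h0] at h

theorem Matrix.det_gram_ne_zero {n : ℕ} {v : Fin n → V} (hv : LinearIndependent ℝ v) :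
    (Matrix.gram ℝ v).det ≠ 0 :=
  (Matrix.posDef_gram_of_linearIndependent hv).det_pos.ne'

theorem Matrix.continuousOn_inv_apply {n : ℕ} (i j : Fin n) :
    ContinuousOn (fun G : Matrix (Fin n) (Fin n) ℝ => G⁻¹ i j) {G | G.det ≠ 0} := by
  have hdet : Continuous fun G : Matrix (Fin n) (Fin n) ℝ => G.det := continuous_id.matrix_det
  have hadj : Continuous fun G : Matrix (Fin n) (Fin n) ℝ => G.adjugate i j :=
    continuous_id.matrix_adjugate.matrix_elem i j
  refine ((hdet.continuousOn.inv₀ fun G hG => hG).mul hadj.continuousOn).congr fun G _ => ?_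
  simp [Matrix.inv_def]

variable [FiniteDimensional ℝ V] [NormedAddCommGroup W] [InnerProductSpace ℝ W]

/-- This replaces an orthonormal basis, which has no reason to vary continuously, by the coordinate
frame. If `C` expresses an orthonormal basis in the frame `v` and `G` is the Gram matrix,
orthonormality reads `C G Cᵀ = 1`, whence `G⁻¹ = Cᵀ C`. -/
theorem frobeniusNorm_sq_eq_sum_gram_inv {n : ℕ} (hV : Module.finrank ℝ V = n) (A : V →L[ℝ] W)
    {v : Fin n → V} (hv : LinearIndependent ℝ v) :
    frobeniusNorm A ^ 2 =
      ∑ i, ∑ j, (Matrix.gram ℝ v)⁻¹ i j * inner ℝ (A (v i)) (A (v j)) := by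
  let f : OrthonormalBasis (Fin n) ℝ V := (stdOrthonormalBasis ℝ V).reindex (finCongr hV)
  let b := basisOfLinearIndependentOfCardEqFinrank' v hv (by rw [hV, Fintype.card_fin])
  have hb : ∀ i, b i = v i := fun i => by simp [b]
  let C : Matrix (Fin n) (Fin n) ℝ := Matrix.of fun l i => b.repr (f l) i
  have hf : ∀ l, f l = ∑ i, C l i • v i := fun l => by
    conv_lhs => rw [← b.sum_repr (f l)]
    simp [C, hb]
  have h1 : C * (Matrix.gram ℝ v * C.transpose) = 1 := by
    ext l m
    have h2 := orthonormal_iff_ite.1 f.orthonormal l m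
    rw [hf l, hf m, sum_inner] at h2
    rw [Matrix.one_apply, ← h2, Matrix.mul_apply]
    refine Finset.sum_congr rfl fun i _ => ?_
    rw [Matrix.mul_apply, inner_sum, Finset.mul_sum]
    refine Finset.sum_congr rfl fun j _ => ?_
    rw [real_inner_smul_left, real_inner_smul_right, Matrix.gram_apply, Matrix.transpose_apply]
    ring
  have h3 : (Matrix.gram ℝ v)⁻¹ = C.transpose * C := by
    refine Matrix.inv_eq_right_inv ?_
    rw [← Matrix.mul_assoc]
    exact mul_eq_one_comm.1 h1
  rw [frobeniusNorm_sq A f, h3]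
  have h4 : ∀ l, ‖A (f l)‖ ^ 2 = ∑ i, ∑ j, C l i * C l j * inner ℝ (A (v i)) (A (v j)) := by
    intro l
    rw [hf l, ← real_inner_self_eq_norm_sq, map_sum, sum_inner]
    refine Finset.sum_congr rfl fun i _ => ?_
    rw [inner_sum]
    refine Finset.sum_congr rfl fun j _ => ?_
    rw [map_smul, map_smul, real_inner_smul_left, real_inner_smul_right]
    ring
  simp_rw [h4]
  rw [Finset.sum_comm]
  refine Finset.sum_congr rfl fun i _ => ?_
  rw [Finset.sum_comm]
  refine Finset.sum_congr rfl fun j _ => ?_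
  rw [Matrix.mul_apply, Finset.sum_mul]
  rfl

end Frames

section Inner

variable {E : Type*} [NormedAddCommGroup E] [NormedSpace ℝ E]
  {H : Type*} [TopologicalSpace H] {I : ModelWithCorners ℝ E H}
  {M : Type*} [TopologicalSpace M] [ChartedSpace H M] [IsManifold I ∞ M]
  [RiemannianBundle (fun x : M => TangentSpace I x)]
  [IsContMDiffRiemannianBundle I ∞ E (fun x : M => TangentSpace I x)]
  {E' : Type*} [NormedAddCommGroup E'] [NormedSpace ℝ E']

/-- The tangent map of `f` is continuous, so the images of constant vectors are continuous in the
total space, and the metric is continuous along them. -/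
theorem continuousOn_inner_mfderivWithin {f : E' → M} {s : Set E'}
    (hf : ContMDiffOn 𝓘(ℝ, E') I ∞ f s) (hs : UniqueDiffOn ℝ s) (v w : E') :
    ContinuousOn (fun y => (inner ℝ (mfderivWithin 𝓘(ℝ, E') I f s y v : TangentSpace I (f y))
      (mfderivWithin 𝓘(ℝ, E') I f s y w : TangentSpace I (f y)) : ℝ)) s := by
  have : IsContinuousRiemannianBundle E (fun x : M => TangentSpace I x) := by
    obtain ⟨g, hg, hg'⟩ :=
      IsContMDiffRiemannianBundle.exists_contMDiff (IB := I) (n := ∞) (F := E)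
        (E := fun x : M => TangentSpace I x)
    exact ⟨⟨g, hg.continuous, hg'⟩⟩
  have h1 := hf.continuousOn_tangentMapWithin (by simp) hs.uniqueMDiffOn
  have h2 : ∀ v : E', ContinuousOn (fun y => (⟨f y, mfderivWithin 𝓘(ℝ, E') I f s y v⟩ :
      TotalSpace E (fun x : M => TangentSpace I x))) s := by
    intro v
    have h3 : Continuous fun y : E' => (⟨y, v⟩ : TangentBundle 𝓘(ℝ, E') E') :=
      (tangentBundleModelSpaceHomeomorph 𝓘(ℝ, E')).symm.continuous.comp
        (continuous_id.prodMk continuous_const : Continuous fun y : E' => (y, v))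
    exact h1.comp h3.continuousOn fun y hy => hy
  exact (h2 v).inner_bundle (h2 w)

end Inner

/-! ### Coefficients of top-degree forms and of the energy density in charts. -/

section Coefficients

variable {n : ℕ} {H : Type*} [TopologicalSpace H]
  {I : ModelWithCorners ℝ (EuclideanSpace ℝ (Fin n)) H}
  {S : Type*} [TopologicalSpace S] [ChartedSpace H S]

/-- The coordinate frame of the preferred chart at `p`. -/
def chartFrame (I : ModelWithCorners ℝ (EuclideanSpace ℝ (Fin n)) H) (p : S)
    (y : EuclideanSpace ℝ (Fin n)) (i : Fin n) : TangentSpace I ((extChartAt I p).symm y) :=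
  mfderivWithin 𝓘(ℝ, EuclideanSpace ℝ (Fin n)) I (extChartAt I p).symm (Set.range I) y
    (EuclideanSpace.single i 1)

theorem linearIndependent_chartFrame [IsManifold I ∞ S] {p : S} {y : EuclideanSpace ℝ (Fin n)}
    (hy : y ∈ (extChartAt I p).target) : LinearIndependent ℝ (chartFrame I p y) := by
  obtain ⟨L, hL⟩ := isInvertible_mfderivWithin_extChartAt_symm (I := I) hy
  have h1 : LinearIndependent ℝ fun i : Fin n => (EuclideanSpace.single i 1 :
      EuclideanSpace ℝ (Fin n)) := by
    have := (EuclideanSpace.basisFun (Fin n) ℝ).toBasis.linearIndependent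
    have hb : (fun i : Fin n => (EuclideanSpace.single i 1 : EuclideanSpace ℝ (Fin n))) =
        (EuclideanSpace.basisFun (Fin n) ℝ).toBasis := by
      funext i
      simp
    rw [hb]
    exact this
  have h2 : LinearIndependent ℝ fun i => L (EuclideanSpace.single i 1) :=
    h1.map' L.toLinearEquiv.toLinearMap L.toLinearEquiv.ker
  have h3 : chartFrame I p y = fun i => L (EuclideanSpace.single i 1) := by
    funext i
    rw [chartFrame, ← hL]
    rfl
  rw [h3]
  exact h2

/-- A top-degree form has continuous coefficients in the preferred charts. -/
def DiffForm.HasContinuousCoeff (θ : DiffForm I S n) : Prop :=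
  ∀ p : S, ContinuousOn (DiffForm.coeff θ p) (extChartAt I p).target

theorem DiffForm.hasContinuousCoeff_of_mem_smoothForms {θ : DiffForm I S n}
    (hθ : θ ∈ smoothForms I S n) : θ.HasContinuousCoeff := fun p =>
  (ContinuousAlternatingMap.apply ℝ (EuclideanSpace ℝ (Fin n)) ℝ _).continuous.comp_continuousOn (hθ p).continuousOn

theorem DiffForm.HasContinuousCoeff.add {θ η : DiffForm I S n} (hθ : θ.HasContinuousCoeff)
    (hη : η.HasContinuousCoeff) : (θ + η).HasContinuousCoeff := fun p => (hθ p).add (hη p)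

theorem DiffForm.HasContinuousCoeff.sub {θ η : DiffForm I S n} (hθ : θ.HasContinuousCoeff)
    (hη : η.HasContinuousCoeff) : (θ - η).HasContinuousCoeff := fun p => (hθ p).sub (hη p)

variable [IsManifold I ∞ S] [RiemannianBundle (fun x : S => TangentSpace I x)]

theorem RiemannianVolumeForm.coeff_ne_zero (vol : RiemannianVolumeForm I S) {p : S}
    {y : EuclideanSpace ℝ (Fin n)} (hy : y ∈ (extChartAt I p).target) :
    DiffForm.coeff vol.form p y ≠ 0 := by
  exact (vol.unit _).apply_ne_zero (linearIndependent_chartFrame hy)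

theorem Real.sign_eq_div_abs (x : ℝ) : Real.sign x = x / |x| := by
  rcases lt_trichotomy x 0 with h | h | h
  · rw [Real.sign_of_neg h, abs_of_neg h, div_neg, div_self h.ne]
  · simp [h]
  · rw [Real.sign_of_pos h, abs_of_pos h, div_self h.ne']

/-- The volume form has no zeros, so `x / |x|` is continuous along its coefficient. -/
theorem RiemannianVolumeForm.continuousOn_sign_coeff (vol : RiemannianVolumeForm I S) (p : S) :
    ContinuousOn (fun y => Real.sign (DiffForm.coeff vol.form p y)) (extChartAt I p).target := by
  have h := DiffForm.hasContinuousCoeff_of_mem_smoothForms vol.smooth p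
  simp_rw [Real.sign_eq_div_abs]
  exact h.div h.abs fun y hy => abs_ne_zero.2 (vol.coeff_ne_zero hy)

variable [IsContMDiffRiemannianBundle I ∞ (EuclideanSpace ℝ (Fin n))
    (fun x : S => TangentSpace I x)]
  {m : ℕ} {M : Type*} [TopologicalSpace M] [ChartedSpace (EuclideanSpace ℝ (Fin m)) M]
  [IsManifold (𝓡 m) ∞ M]
  [RiemannianBundle (fun y : M => TangentSpace (𝓡 m) y)]
  [IsContMDiffRiemannianBundle (𝓡 m) ∞ (EuclideanSpace ℝ (Fin m))
    (fun y : M => TangentSpace (𝓡 m) y)]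

theorem continuousOn_gram_chartFrame (p : S) :
    ContinuousOn (fun y => Matrix.gram ℝ (chartFrame I p y)) (extChartAt I p).target := by
  refine continuousOn_pi.2 fun i => continuousOn_pi.2 fun j => ?_
  refine (continuousOn_inner_mfderivWithin (contMDiffOn_extChartAt_symm p)
    (uniqueDiffOn_extChartAt_target p) (EuclideanSpace.single i 1)
      (EuclideanSpace.single j 1)).congr fun y hy => ?_
  simp only [Matrix.gram_apply, chartFrame]
  rw [mfderivWithin_extChartAt_target_eq _ hy]

/-- Only continuity is sought: the norm itself need not be smooth where `du` vanishes. For this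
reason the integration theory below asks for continuous coefficients only. -/
theorem continuousOn_frobeniusNorm_mfderiv (u : C^∞⟮I, S; 𝓡 m, M⟯) (p : S) :
    ContinuousOn (fun y => frobeniusNorm (mfderiv I (𝓡 m) u ((extChartAt I p).symm y)))
      (extChartAt I p).target := by
  have h1 : ContinuousOn (fun y =>
      frobeniusNorm (mfderiv I (𝓡 m) u ((extChartAt I p).symm y)) ^ 2)
      (extChartAt I p).target := by
    have h2 : ∀ y ∈ (extChartAt I p).target,
        frobeniusNorm (mfderiv I (𝓡 m) u ((extChartAt I p).symm y)) ^ 2 = _ := fun y hy =>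
      frobeniusNorm_sq_eq_sum_gram_inv (by exact finrank_euclideanSpace_fin)
        (mfderiv I (𝓡 m) u ((extChartAt I p).symm y)) (linearIndependent_chartFrame hy)
    refine ContinuousOn.congr ?_ h2
    refine continuousOn_finsetSum _ fun i _ => continuousOn_finsetSum _ fun j _ => ?_
    refine ContinuousOn.mul ?_ ?_
    · exact (Matrix.continuousOn_inv_apply i j).comp (continuousOn_gram_chartFrame (I := I) p)
        fun y hy => Matrix.det_gram_ne_zero (linearIndependent_chartFrame hy)
    · refine (continuousOn_inner_mfderivWithin (u.contMDiff.comp_contMDiffOn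
        (contMDiffOn_extChartAt_symm p)) (uniqueDiffOn_extChartAt_target p)
        (EuclideanSpace.single i 1) (EuclideanSpace.single j 1)).congr fun y hy => ?_
      have h4 : mfderivWithin 𝓘(ℝ, EuclideanSpace ℝ (Fin n)) (𝓡 m) (u ∘ (extChartAt I p).symm)
          (extChartAt I p).target y = _ :=
        (mfderivWithin_extChartAt_target_eq _ hy).trans
        (mfderiv_comp_mfderivWithin y (u.contMDiff.mdifferentiableAt (by simp))
          (mdifferentiableWithinAt_extChartAt_symm hy)
          (I.uniqueMDiffOn _ (extChartAt_target_subset_range p hy)))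
      have h5 : ∀ i, mfderiv I (𝓡 m) u ((extChartAt I p).symm y) (chartFrame I p y i) =
          mfderivWithin 𝓘(ℝ, EuclideanSpace ℝ (Fin n)) (𝓡 m) (u ∘ (extChartAt I p).symm)
            (extChartAt I p).target y (EuclideanSpace.single i 1) := fun i =>
        (congrArg (fun L : EuclideanSpace ℝ (Fin n) →L[ℝ] EuclideanSpace ℝ (Fin m) =>
          L (EuclideanSpace.single i 1)) h4).symm
      exact congrArg₂ (fun a b : TangentSpace (𝓡 m) (u ((extChartAt I p).symm y)) =>
        (inner ℝ a b : ℝ)) (h5 i) (h5 j)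
  refine h1.sqrt.congr fun y _ => ?_
  exact (Real.sqrt_sq (Real.sqrt_nonneg _)).symm

end Coefficients

/-! ### Integration of top-degree forms -/

section Integration

open MeasureTheory

variable {n : ℕ} {H : Type*} [TopologicalSpace H]
  {I : ModelWithCorners ℝ (EuclideanSpace ℝ (Fin n)) H}
  {S : Type*} [TopologicalSpace S] [ChartedSpace H S]

theorem measurableSet_extChartAt_target (p : S) : MeasurableSet (extChartAt I p).target := by
  rw [extChartAt_target]
  exact (((chartAt H p).open_target.preimage I.continuous_symm).measurableSet).inter
    I.isClosed_range.measurableSet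

variable [IsManifold I ∞ S] [T2Space S]

theorem chartPartition_isSubordinate [SigmaCompactSpace S] :
    (chartPartition I S).IsSubordinate fun p => (chartAt H p).source :=
  (SmoothPartitionOfUnity.exists_isSubordinate_chartAt_source I S).choose_spec

theorem SmoothPartitionOfUnity.finite_ne_zero [CompactSpace S] {ι : Type*}
    (ρ : SmoothPartitionOfUnity ι I S Set.univ) : {i | ∃ x, ρ i x ≠ 0}.Finite :=
  ρ.locallyFinite.finite_nonempty_of_compact

variable [CompactSpace S] [RiemannianBundle (fun x : S => TangentSpace I x)]

/-- The integrand in the definition of `integralForm`. -/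
def chartIntegrand (vol : RiemannianVolumeForm I S) (θ : DiffForm I S n) (p : S)
    (y : EuclideanSpace ℝ (Fin n)) : ℝ :=
  Real.sign (DiffForm.coeff vol.form p y) *
    (chartPartition I S p ((extChartAt I p).symm y) * DiffForm.coeff θ p y)

variable (vol : RiemannianVolumeForm I S) {θ η : DiffForm I S n}

theorem continuousOn_chartIntegrand (hθ : θ.HasContinuousCoeff) (p : S) :
    ContinuousOn (chartIntegrand vol θ p) (extChartAt I p).target :=
  (vol.continuousOn_sign_coeff p).mul
    (((chartPartition I S p).contMDiff.continuous.comp_continuousOn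
      (continuousOn_extChartAt_symm p)).mul (hθ p))

/-- The coefficient may be unbounded on the chart target, but the partition function vanishes off a
compact subset of it, where continuity gives integrability. -/
theorem integrableOn_chartIntegrand (hθ : θ.HasContinuousCoeff) (p : S) :
    IntegrableOn (chartIntegrand vol θ p) (extChartAt I p).target := by
  have hsub : tsupport (chartPartition I S p) ⊆ (extChartAt I p).source := by
    rw [extChartAt_source]; exact chartPartition_isSubordinate p
  have hK : IsCompact (extChartAt I p '' tsupport (chartPartition I S p)) :=
    (isClosed_tsupport _).isCompact.image_of_continuousOn
      ((continuousOn_extChartAt p).mono hsub)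
  have hKsub : extChartAt I p '' tsupport (chartPartition I S p) ⊆ (extChartAt I p).target := by
    rintro _ ⟨x, hx, rfl⟩
    exact (extChartAt I p).map_source (hsub hx)
  refine (((continuousOn_chartIntegrand vol hθ p).mono hKsub).integrableOn_compact hK)
    |>.of_forall_sdiff_eq_zero (measurableSet_extChartAt_target p) fun y hy => ?_
  have : chartPartition I S p ((extChartAt I p).symm y) = 0 := by
    by_contra h
    exact hy.2 ⟨_, subset_tsupport _ h, (extChartAt I p).right_inv hy.1⟩
  rw [chartIntegrand, this, zero_mul, mul_zero]

theorem integralForm_eq_sum (θ : DiffForm I S n) {s : Finset S}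
    (hs : {p | ∃ x, chartPartition I S p x ≠ 0} ⊆ s) :
    integralForm vol θ = ∑ p ∈ s, ∫ y in (extChartAt I p).target, chartIntegrand vol θ p y := by
  refine finsum_eq_sum_of_support_subset _ fun p hp => hs ?_
  by_contra h
  have h' : ∀ x, chartPartition I S p x = 0 := fun x => by
    by_contra hx
    exact h ⟨x, hx⟩
  refine hp ?_
  simp only [h', zero_mul, mul_zero, integral_zero]

theorem exists_finset_chartPartition_subset (I : ModelWithCorners ℝ (EuclideanSpace ℝ (Fin n)) H)
    (S : Type*) [TopologicalSpace S] [ChartedSpace H S] [IsManifold I ∞ S] [T2Space S]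
    [CompactSpace S] : ∃ s : Finset S, {p | ∃ x, chartPartition I S p x ≠ 0} ⊆ s :=
  ⟨((chartPartition I S).finite_ne_zero).toFinset, by simp⟩

theorem integralForm_add (hθ : θ.HasContinuousCoeff) (hη : η.HasContinuousCoeff) :
    integralForm vol (θ + η) = integralForm vol θ + integralForm vol η := by
  obtain ⟨s, hs⟩ := exists_finset_chartPartition_subset I S
  rw [integralForm_eq_sum vol _ hs, integralForm_eq_sum vol _ hs, integralForm_eq_sum vol _ hs,
    ← Finset.sum_add_distrib]
  refine Finset.sum_congr rfl fun p _ => ?_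
  rw [← integral_add (integrableOn_chartIntegrand vol hθ p) (integrableOn_chartIntegrand vol hη p)]
  congr 1
  funext y
  have : DiffForm.coeff (θ + η) p y = DiffForm.coeff θ p y + DiffForm.coeff η p y := rfl
  rw [chartIntegrand, chartIntegrand, chartIntegrand, this]
  ring

theorem integralForm_zero : integralForm vol (0 : DiffForm I S n) = 0 := by
  obtain ⟨s, hs⟩ := exists_finset_chartPartition_subset I S
  rw [integralForm_eq_sum vol _ hs]
  refine Finset.sum_eq_zero fun p _ => ?_
  have : ∀ y, chartIntegrand vol (0 : DiffForm I S n) p y = 0 := fun y => by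
    have h0 : DiffForm.coeff (0 : DiffForm I S n) p y = 0 := rfl
    rw [chartIntegrand, h0, mul_zero, mul_zero]
  simp [this]

theorem DiffForm.HasContinuousCoeff.sum {ι : Type*} {s : Finset ι} {θ : ι → DiffForm I S n}
    (hθ : ∀ i ∈ s, (θ i).HasContinuousCoeff) :
    DiffForm.HasContinuousCoeff (∑ i ∈ s, θ i) ∧
      integralForm vol (∑ i ∈ s, θ i) = ∑ i ∈ s, integralForm vol (θ i) := by
  classical
  induction s using Finset.induction_on with
  | empty =>
    refine ⟨fun p => ?_, integralForm_zero vol⟩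
    have : DiffForm.coeff (∑ i ∈ (∅ : Finset ι), θ i) p = fun _ => 0 := rfl
    rw [this]
    exact continuousOn_const
  | insert a s ha ih =>
    obtain ⟨h1, h2⟩ := ih fun i hi => hθ i (Finset.mem_insert_of_mem hi)
    have h3 := hθ a (Finset.mem_insert_self a s)
    rw [Finset.sum_insert ha, Finset.sum_insert ha]
    exact ⟨h3.add h1, by rw [integralForm_add vol h3 h1, h2]⟩

theorem sign_mul_chartPartition_nonneg {a : ℝ} {p x : S} {y : EuclideanSpace ℝ (Fin n)}
    (h : 0 ≤ Real.sign (DiffForm.coeff vol.form p y) * a) :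
    0 ≤ Real.sign (DiffForm.coeff vol.form p y) * (chartPartition I S p x * a) := by
  rw [mul_left_comm]
  exact mul_nonneg ((chartPartition I S).nonneg p x) h

/-- The integral of a nonnegative form is nonnegative. -/
theorem integralForm_nonneg (h : ∀ p, ∀ y ∈ (extChartAt I p).target,
      0 ≤ Real.sign (DiffForm.coeff vol.form p y) * DiffForm.coeff θ p y) :
    0 ≤ integralForm vol θ := by
  obtain ⟨s, hs⟩ := exists_finset_chartPartition_subset I S
  rw [integralForm_eq_sum vol _ hs]
  exact Finset.sum_nonneg fun p _ => setIntegral_nonneg (measurableSet_extChartAt_target p)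
    fun y hy => sign_mul_chartPartition_nonneg vol (h p y hy)

/-- The integral of a nonnegative form vanishes if and only if the form does. -/
theorem integralForm_eq_zero_iff (hθ : θ.HasContinuousCoeff)
    (h : ∀ p, ∀ y ∈ (extChartAt I p).target,
      0 ≤ Real.sign (DiffForm.coeff vol.form p y) * DiffForm.coeff θ p y) :
    integralForm vol θ = 0 ↔ ∀ p, ∀ y ∈ (extChartAt I p).target,
      chartPartition I S p ((extChartAt I p).symm y) ≠ 0 →
        Real.sign (DiffForm.coeff vol.form p y) * DiffForm.coeff θ p y = 0 := by
  obtain ⟨s, hs⟩ := exists_finset_chartPartition_subset I S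
  have hnn : ∀ p, ∀ y ∈ (extChartAt I p).target, 0 ≤ chartIntegrand vol θ p y := fun p y hy =>
    sign_mul_chartPartition_nonneg vol (h p y hy)
  rw [integralForm_eq_sum vol _ hs, Finset.sum_eq_zero_iff_of_nonneg fun p _ =>
    setIntegral_nonneg (measurableSet_extChartAt_target p) (hnn p)]
  constructor
  · intro h0 p y hy hρ
    have h1 := h0 p (hs ⟨_, hρ⟩)
    rw [setIntegral_eq_zero_iff_of_nonneg_ae
      ((ae_restrict_iff' (measurableSet_extChartAt_target p)).2 (Filter.Eventually.of_forall
        (hnn p))) (integrableOn_chartIntegrand vol hθ p)] at h1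
    -- The chart target lies in the closure of its interior, so a continuous function vanishing
    -- almost everywhere there vanishes everywhere, boundary points included.
    have h2 := Measure.eqOn_of_ae_eq h1 (continuousOn_chartIntegrand vol hθ p) continuousOn_const
      extChartAt_target_subset_closure_interior hy
    rw [chartIntegrand, mul_left_comm] at h2
    exact (mul_eq_zero.1 h2).resolve_left hρ
  · intro h0 p _
    refine setIntegral_eq_zero_of_forall_eq_zero fun y hy => ?_
    rw [chartIntegrand, mul_left_comm]
    by_cases hρ : chartPartition I S p ((extChartAt I p).symm y) = 0
    · rw [hρ, zero_mul]
    · rw [h0 p y hy hρ, mul_zero]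

end Integration

/-! ### The energy identity. -/

section Energy

variable {k : ℕ} {H : Type*} [TopologicalSpace H]
  {I : ModelWithCorners ℝ (EuclideanSpace ℝ (Fin (k + 1))) H}
  {S : Type*} [TopologicalSpace S] [ChartedSpace H S] [IsManifold I ∞ S]
  [T2Space S] [CompactSpace S]
  [RiemannianBundle (fun x : S => TangentSpace I x)]
  [IsContMDiffRiemannianBundle I ∞ (EuclideanSpace ℝ (Fin (k + 1)))
    (fun x : S => TangentSpace I x)]
  {m : ℕ} {M : Type*} [TopologicalSpace M] [ChartedSpace (EuclideanSpace ℝ (Fin m)) M]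
  [IsManifold (𝓡 m) ∞ M]
  [RiemannianBundle (fun y : M => TangentSpace (𝓡 m) y)]
  [IsContMDiffRiemannianBundle (𝓡 m) ∞ (EuclideanSpace ℝ (Fin m))
    (fun y : M => TangentSpace (𝓡 m) y)]

theorem hasContinuousCoeff_energyForm (vol : RiemannianVolumeForm I S)
    (u : C^∞⟮I, S; 𝓡 m, M⟯) : (energyForm vol u).HasContinuousCoeff := fun p =>
  (continuousOn_const.mul ((continuousOn_frobeniusNorm_mfderiv u p).pow _)).mul
    (DiffForm.hasContinuousCoeff_of_mem_smoothForms vol.smooth p)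

theorem hasContinuousCoeff_pullback (u : C^∞⟮I, S; 𝓡 m, M⟯)
    (α : smoothForms (𝓡 m) M (k + 1)) : (DiffForm.pullback u α.1).HasContinuousCoeff :=
  DiffForm.hasContinuousCoeff_of_mem_smoothForms (DiffForm.pullback_mem_smoothForms u α.2)

/-- In every chart, `|du|ⁿ vol / (√n)ⁿ - u^*α` is nonnegative, and it vanishes exactly where `du`
is a linear Smith map. -/
theorem sign_mul_coeff_energyForm_sub (hk : 1 ≤ k) (vol : RiemannianVolumeForm I S)
    (X : VectorCrossProductStructure k m M) (u : C^∞⟮I, S; 𝓡 m, M⟯) (p : S)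
    {y : EuclideanSpace ℝ (Fin (k + 1))} (hy : y ∈ (extChartAt I p).target) :
    0 ≤ Real.sign (DiffForm.coeff vol.form p y) *
        DiffForm.coeff (energyForm vol u - DiffForm.pullback u X.α.1) p y ∧
      (Real.sign (DiffForm.coeff vol.form p y) *
        DiffForm.coeff (energyForm vol u - DiffForm.pullback u X.α.1) p y = 0 ↔
      IsLinearSmithMap (vol.form ((extChartAt I p).symm y)) (X.Q (u ((extChartAt I p).symm y)))
        (mfderiv I (𝓡 m) u ((extChartAt I p).symm y))) := by
  have h := (X.isVectorCrossProduct (u ((extChartAt I p).symm y))).sign_mul_energy_sub hk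
    (by exact finrank_euclideanSpace_fin) (vol.unit ((extChartAt I p).symm y))
    (X.α_apply (u ((extChartAt I p).symm y)))
    (mfderiv I (𝓡 m) u ((extChartAt I p).symm y)) (chartFrame I p y)
  exact ⟨h.1, h.2 (vol.coeff_ne_zero hy)⟩

theorem energy_identity (hk : 1 ≤ k) (vol : RiemannianVolumeForm I S)
    (X : VectorCrossProductStructure k m M) (u : C^∞⟮I, S; 𝓡 m, M⟯) :
    nEnergy vol u = integralForm vol (energyForm vol u - DiffForm.pullback u X.α.1) +
        integralForm vol (DiffForm.pullback u X.α.1) ∧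
      0 ≤ integralForm vol (energyForm vol u - DiffForm.pullback u X.α.1) ∧
      (integralForm vol (energyForm vol u - DiffForm.pullback u X.α.1) = 0 ↔
        IsSmithMap vol X u) := by
  have hc1 := hasContinuousCoeff_energyForm vol u
  have hc2 := hasContinuousCoeff_pullback u X.α
  refine ⟨?_, ?_, ?_⟩
  · rw [← integralForm_add vol (hc1.sub hc2) hc2, sub_add_cancel]
    rfl
  · exact integralForm_nonneg vol fun p y hy => (sign_mul_coeff_energyForm_sub hk vol X u p hy).1
  · rw [integralForm_eq_zero_iff vol (hc1.sub hc2) fun p y hy =>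
      (sign_mul_coeff_energyForm_sub hk vol X u p hy).1]
    constructor
    · intro h x
      -- Vanishing of the integrals gives information only where the partition function is nonzero;
      -- some chart index `p` has this property at `x`.
      obtain ⟨p, hp⟩ := (chartPartition I S).exists_pos_of_mem (Set.mem_univ x)
      have hx : x ∈ (extChartAt I p).source := by
        rw [extChartAt_source]
        exact chartPartition_isSubordinate p (subset_tsupport _ hp.ne')
      have hy := (extChartAt I p).map_source hx
      have h1 := (sign_mul_coeff_energyForm_sub hk vol X u p hy).2.1
        (h p _ hy (by rw [(extChartAt I p).left_inv hx]; exact hp.ne'))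
      have aux : ∀ z, z = x → IsLinearSmithMap (vol.form z) (X.Q (u z)) (mfderiv I (𝓡 m) u z) →
          IsLinearSmithMap (vol.form x) (X.Q (u x)) (mfderiv I (𝓡 m) u x) := by
        rintro z rfl h; exact h
      exact aux _ ((extChartAt I p).left_inv hx) h1
    · intro h p y hy _
      exact (sign_mul_coeff_energyForm_sub hk vol X u p hy).2.2 (h _)

end Energy

/-! ### Stokes' theorem on the standard simplex -/

section Simplex

open MeasureTheory

variable {n : ℕ}

theorem isClosed_simplexDomain (n : ℕ) : IsClosed (simplexDomain n) := by
  have h1 : IsClosed {t : Fin n → ℝ | ∀ i, 0 ≤ t i} := by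
    rw [Set.ofPred_forall]
    exact isClosed_iInter fun i => isClosed_le continuous_const (continuous_apply i)
  exact h1.inter (isClosed_le (continuous_finsetSum _ fun i _ => continuous_apply i)
    continuous_const)

theorem simplexDomain_subset_Icc (n : ℕ) : simplexDomain n ⊆ Set.Icc 0 1 := fun _ ht =>
  ⟨fun i => ht.1 i, fun i =>
    (Finset.single_le_sum (fun j _ => ht.1 j) (Finset.mem_univ i)).trans ht.2⟩

theorem isCompact_simplexDomain (n : ℕ) : IsCompact (simplexDomain n) :=
  isCompact_Icc.of_isClosed_subset (isClosed_simplexDomain n) (simplexDomain_subset_Icc n)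

theorem convex_simplexDomain (n : ℕ) : Convex ℝ (simplexDomain n) := by
  intro x hx y hy a b ha hb hab
  refine ⟨fun i => ?_, ?_⟩
  · exact add_nonneg (mul_nonneg ha (hx.1 i)) (mul_nonneg hb (hy.1 i))
  · simp only [Pi.add_apply, Pi.smul_apply, smul_eq_mul, Finset.sum_add_distrib, ← Finset.mul_sum]
    calc a * ∑ i, x i + b * ∑ i, y i ≤ a * 1 + b * 1 :=
          add_le_add (mul_le_mul_of_nonneg_left hx.2 ha) (mul_le_mul_of_nonneg_left hy.2 hb)
      _ = 1 := by linarith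

theorem mem_interior_simplexDomain {t : Fin n → ℝ} (h0 : ∀ i, 0 < t i) (h1 : ∑ i, t i < 1) :
    t ∈ interior (simplexDomain n) := by
  have hU : IsOpen ({t : Fin n → ℝ | ∀ i, 0 < t i} ∩ {t | ∑ i, t i < 1}) := by
    refine IsOpen.inter ?_ (isOpen_lt (continuous_finsetSum _ fun i _ => continuous_apply i)
      continuous_const)
    rw [Set.ofPred_forall]
    exact isOpen_iInter_of_finite fun i => isOpen_lt continuous_const (continuous_apply i)
  exact interior_maximal (s := simplexDomain n) (fun t ht => ⟨fun i => (ht.1 i).le, ht.2.le⟩) hU ⟨h0, h1⟩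

theorem interior_simplexDomain_nonempty (n : ℕ) : (interior (simplexDomain n)).Nonempty := by
  have hn : (0 : ℝ) < n + 1 := by positivity
  refine ⟨fun _ => 1 / (n + 1), mem_interior_simplexDomain (fun _ => by positivity) ?_⟩
  simp only [Finset.sum_const, Finset.card_univ, Fintype.card_fin, nsmul_eq_mul]
  rw [mul_one_div, div_lt_one hn]
  linarith

theorem volume_real_simplexDomain_ne_zero (n : ℕ) : volume.real (simplexDomain n) ≠ 0 := by
  refine ENNReal.toReal_ne_zero.2 ⟨?_, (isCompact_simplexDomain n).measure_lt_top.ne⟩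
  exact ((isOpen_interior.measure_pos volume (interior_simplexDomain_nonempty n)).trans_le
    (measure_mono interior_subset)).ne'

theorem ae_mem_interior_simplexDomain (n : ℕ) :
    ∀ᵐ t ∂volume.restrict (simplexDomain n), t ∈ interior (simplexDomain n) := by
  rw [ae_restrict_iff' (isClosed_simplexDomain n).measurableSet]
  have h := (convex_simplexDomain n).addHaar_frontier volume
  filter_upwards [compl_mem_ae_iff.2 h] with t ht htD
  by_contra h'
  exact ht ⟨subset_closure htD, h'⟩

/-- An affine bijection of the simplex preserves integrals. -/
theorem setIntegral_simplexDomain_comp (L : (Fin n → ℝ) →L[ℝ] (Fin n → ℝ)) (c : Fin n → ℝ)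
    (hinj : Function.Injective fun s => L s + c)
    (himage : (fun s => L s + c) '' simplexDomain n = simplexDomain n) (h : (Fin n → ℝ) → ℝ) :
    ∫ s in simplexDomain n, h (L s + c) = ∫ s in simplexDomain n, h s := by
  have key := fun g : (Fin n → ℝ) → ℝ => integral_image_eq_integral_abs_det_fderiv_smul volume
    (isClosed_simplexDomain n).measurableSet
    (fun x _ => (L.hasFDerivAt (x := x)).add_const c |>.hasFDerivWithinAt) hinj.injOn g
  simp only [himage] at key
  -- Taking the integrand `1` shows that `|det L|` times the volume of the simplex is that volume.
  -- As the volume is nonzero, `|det L| = 1` without computing a determinant.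
  have h1 := key fun _ => 1
  simp only [smul_eq_mul, mul_one, setIntegral_const] at h1
  have hdet : |L.det| = 1 := by
    have h2 := volume_real_simplexDomain_ne_zero n
    exact (mul_left_cancel₀ h2 ((mul_one _).trans h1)).symm
  rw [key h, hdet]
  simp

theorem insertNth_mem_simplexDomain_iff (i : Fin (n + 1)) (x : ℝ) (s : Fin n → ℝ) :
    (i.insertNth x s : Fin (n + 1) → ℝ) ∈ simplexDomain (n + 1) ↔
      s ∈ simplexDomain n ∧ x ∈ Set.Icc 0 (1 - ∑ j, s j) := by
  simp only [simplexDomain, Set.mem_ofPred_eq, Set.mem_Icc, Fin.forall_iff_succAbove i,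
    Fin.insertNth_apply_same, Fin.insertNth_apply_succAbove, Fin.sum_univ_succAbove _ i]
  constructor
  · rintro ⟨⟨h1, h2⟩, h3⟩
    exact ⟨⟨h2, by linarith⟩, h1, by linarith⟩
  · rintro ⟨⟨h1, h2⟩, h3, h4⟩
    exact ⟨⟨h3, h1⟩, by linarith⟩

/-- Fubini's theorem on the simplex. -/
theorem setIntegral_simplexDomain_succ (i : Fin (n + 1)) {f : (Fin (n + 1) → ℝ) → ℝ}
    (hf : ContinuousOn f (simplexDomain (n + 1))) :
    ∫ t in simplexDomain (n + 1), f t =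
      ∫ s in simplexDomain n, ∫ x in (0 : ℝ)..(1 - ∑ j, s j), f (i.insertNth x s) := by
  have hmp := (volume_preserving_piFinSuccAbove (fun _ : Fin (n + 1) => ℝ) i).symm
  have hint : Integrable ((simplexDomain (n + 1)).indicator f) :=
    (integrable_indicator_iff (isClosed_simplexDomain _).measurableSet).2
      (hf.integrableOn_compact (isCompact_simplexDomain _))
  rw [← integral_indicator (isClosed_simplexDomain _).measurableSet,
    ← hmp.integral_comp (MeasurableEquiv.measurableEmbedding _), Measure.volume_eq_prod,
    integral_prod_symm _ (by
      rw [← Measure.volume_eq_prod]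
      exact (hmp.integrable_comp_emb (MeasurableEquiv.measurableEmbedding _)).2 hint),
    ← integral_indicator (isClosed_simplexDomain n).measurableSet]
  congr 1
  funext s
  have hsymm : ∀ x, (MeasurableEquiv.piFinSuccAbove (fun _ : Fin (n + 1) => ℝ) i).symm (x, s) =
      i.insertNth x s := fun x => rfl
  simp only [hsymm]
  by_cases hs : s ∈ simplexDomain n
  · rw [Set.indicator_of_mem hs, intervalIntegral.integral_of_le (by linarith [hs.2]),
      ← integral_Icc_eq_integral_Ioc, ← integral_indicator measurableSet_Icc]
    congr 1
    funext x
    by_cases hx : x ∈ Set.Icc 0 (1 - ∑ j, s j)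
    · rw [Set.indicator_of_mem hx,
        Set.indicator_of_mem ((insertNth_mem_simplexDomain_iff i x s).2 ⟨hs, hx⟩)]
    · rw [Set.indicator_of_notMem hx, Set.indicator_of_notMem
        fun h => hx ((insertNth_mem_simplexDomain_iff i x s).1 h).2]
  · rw [Set.indicator_of_notMem hs]
    have : ∀ x, (simplexDomain (n + 1)).indicator f (i.insertNth x s) = 0 := fun x =>
      Set.indicator_of_notMem (fun h => hs ((insertNth_mem_simplexDomain_iff i x s).1 h).1) _
    simp [this]

/-- All ways of parametrizing the face `∑ tᵢ = 1` by the coordinates other than one of them give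
the same integral. -/
theorem setIntegral_insertNth_eq (i : Fin (n + 1)) (h : (Fin (n + 1) → ℝ) → ℝ) :
    ∫ s in simplexDomain n, h (i.insertNth (1 - ∑ j, s j) s) =
      ∫ s in simplexDomain n, h (Fin.cons (1 - ∑ j, s j) s) := by
  have hadd : ∀ (s t : Fin n → ℝ) (l : Fin (n + 1)),
      (Fin.cons (-∑ j, (s + t) j) (s + t) : Fin (n + 1) → ℝ) l =
        (Fin.cons (-∑ j, s j) s : Fin (n + 1) → ℝ) l +
          (Fin.cons (-∑ j, t j) t : Fin (n + 1) → ℝ) l := by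
    intro s t l
    refine Fin.cases ?_ (fun l => ?_) l <;> simp [Finset.sum_add_distrib, add_comm]
  have hsmul : ∀ (c : ℝ) (s : Fin n → ℝ) (l : Fin (n + 1)),
      (Fin.cons (-∑ j, (c • s) j) (c • s) : Fin (n + 1) → ℝ) l =
        c • (Fin.cons (-∑ j, s j) s : Fin (n + 1) → ℝ) l := by
    intro c s l
    refine Fin.cases ?_ (fun l => ?_) l <;> simp [Finset.mul_sum]
  have hsub : ∀ (s : Fin n → ℝ) (l : Fin (n + 1)),
      (Fin.cons (-∑ j, s j) s : Fin (n + 1) → ℝ) l + (Fin.cons 1 0 : Fin (n + 1) → ℝ) l =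
        (Fin.cons (1 - ∑ j, s j) s : Fin (n + 1) → ℝ) l := by
    intro s l
    refine Fin.cases ?_ (fun l => ?_) l <;> simp [sub_eq_neg_add]
  -- `C s + c` completes `s` to a point of the hyperplane `∑ tₗ = 1` and drops coordinate `i`. The
  -- dropped coordinate is determined by the others, so this is an affine bijection of the simplex.
  let C : (Fin n → ℝ) →ₗ[ℝ] (Fin n → ℝ) :=
    { toFun := fun s j => (Fin.cons (-∑ j, s j) s : Fin (n + 1) → ℝ) (i.succAbove j)
      map_add' := fun s t => funext fun j => hadd s t _
      map_smul' := fun c s => funext fun j => hsmul c s _ }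
  let c : Fin n → ℝ := fun j => (Fin.cons 1 0 : Fin (n + 1) → ℝ) (i.succAbove j)
  have hT : ∀ s, C.toContinuousLinearMap s + c =
      i.removeNth (Fin.cons (1 - ∑ j, s j) s : Fin (n + 1) → ℝ) := by
    exact fun s => funext fun j => hsub s _
  have hcons : ∀ s : Fin n → ℝ, ∑ l, (Fin.cons (1 - ∑ j, s j) s : Fin (n + 1) → ℝ) l = 1 := by
    intro s; simp [Fin.sum_univ_succ]
  have hsum : ∀ t : Fin (n + 1) → ℝ, ∑ l, t l = 1 → 1 - ∑ j, i.removeNth t j = t i := by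
    intro t ht
    rw [Fin.sum_univ_succAbove _ i] at ht
    simp only [Fin.removeNth_apply]
    linarith
  have hback : ∀ t : Fin (n + 1) → ℝ, ∑ l, t l = 1 →
      i.insertNth (1 - ∑ j, i.removeNth t j) (i.removeNth t) = t := by
    intro t ht
    rw [hsum t ht, Fin.insertNth_self_removeNth]
  have hmem : ∀ t : Fin (n + 1) → ℝ, ∑ l, t l = 1 → (∀ l, 0 ≤ t l) → ∀ i : Fin (n + 1),
      i.removeNth t ∈ simplexDomain n := by
    intro t ht ht0 i
    refine ⟨fun j => ht0 _, ?_⟩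
    rw [Fin.sum_univ_succAbove _ i] at ht
    simp only [Fin.removeNth_apply]
    linarith [ht0 i]
  have hinj : Function.Injective fun s => C.toContinuousLinearMap s + c := by
    intro s s' hss
    simp only [hT] at hss
    have := congrArg (fun r : Fin n → ℝ => (i.insertNth (1 - ∑ j, r j) r : Fin (n + 1) → ℝ)) hss
    simp only [hback _ (hcons _)] at this
    exact (Fin.cons_injective2 this).2
  have hnonneg : ∀ s ∈ simplexDomain n, ∀ l,
      0 ≤ (Fin.cons (1 - ∑ j, s j) s : Fin (n + 1) → ℝ) l := by
    intro s hs l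
    refine Fin.cases ?_ (fun l => ?_) l
    · simpa using hs.2
    · simpa using hs.1 l
  have himage : (fun s => C.toContinuousLinearMap s + c) '' simplexDomain n = simplexDomain n := by
    ext r
    simp only [Set.mem_image, hT]
    constructor
    · rintro ⟨s, hs, rfl⟩
      exact hmem _ (hcons s) (hnonneg s hs) i
    · intro hr
      set t : Fin (n + 1) → ℝ := i.insertNth (1 - ∑ j, r j) r with ht
      have ht1 : ∑ l, t l = 1 := by simp [ht, Fin.sum_univ_succAbove _ i]
      have ht0 : ∀ l, 0 ≤ t l := by
        rw [Fin.forall_iff_succAbove i]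
        exact ⟨by simpa [ht] using hr.2, fun j => by simpa [ht] using hr.1 j⟩
      refine ⟨Fin.removeNth 0 t, hmem t ht1 ht0 0, ?_⟩
      have h0 : 1 - ∑ j, Fin.removeNth 0 t j = t 0 := by
        rw [Fin.sum_univ_succ] at ht1
        simp only [Fin.removeNth_apply, Fin.succAbove_zero]
        linarith
      rw [h0, ← Fin.insertNth_zero', Fin.insertNth_self_removeNth, ht, Fin.removeNth_insertNth]
  rw [← setIntegral_simplexDomain_comp C.toContinuousLinearMap c hinj himage]
  simp only [hT, hback _ (hcons _)]

/-- Fubini and the fundamental theorem of calculus in direction `i`. The upper endpoints sweep out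
the oblique face `∑ tⱼ = 1`; its parametrization is then changed to one that does not depend on `i`,
so that the terms for different `i` can be added. -/
theorem integral_partial_simplexDomain (i : Fin (n + 1)) {V : Set (Fin (n + 1) → ℝ)}
    (hV : IsOpen V) (hDV : simplexDomain (n + 1) ⊆ V) {g : (Fin (n + 1) → ℝ) → ℝ}
    (hg : ContDiffOn ℝ 1 g V) :
    ∫ t in simplexDomain (n + 1), fderivWithin ℝ g V t (Pi.single i 1) =
      (∫ s in simplexDomain n, g (Fin.cons (1 - ∑ j, s j) s)) -
        ∫ s in simplexDomain n, g (i.insertNth 0 s) := by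
  have hcont : ContinuousOn (fun t => fderivWithin ℝ g V t (Pi.single i 1)) V :=
    (hg.continuousOn_fderivWithin hV.uniqueDiffOn le_rfl).clm_apply continuousOn_const
  have hins : ∀ (s : Fin n → ℝ) (x : ℝ),
      HasDerivAt (fun x : ℝ => (i.insertNth x s : Fin (n + 1) → ℝ)) (Pi.single i 1) x := by
    intro s x
    rw [hasDerivAt_pi, Fin.forall_iff_succAbove i]
    refine ⟨by simpa using hasDerivAt_id' x, fun j => ?_⟩
    simpa using hasDerivAt_const x (s j)
  have hcc : ∀ y : (Fin n → ℝ) → ℝ, Continuous y →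
      Continuous fun s : Fin n → ℝ => (i.insertNth (y s) s : Fin (n + 1) → ℝ) := by
    intro y hy
    rw [continuous_pi_iff, Fin.forall_iff_succAbove i]
    exact ⟨by simpa using hy, fun j => by simpa using continuous_apply j⟩
  have hsumc : Continuous fun s : Fin n → ℝ => 1 - ∑ j, s j := by fun_prop
  have hinteg : ∀ y : (Fin n → ℝ) → ℝ, Continuous y →
      (∀ s ∈ simplexDomain n, y s ∈ Set.Icc 0 (1 - ∑ j, s j)) →
      IntegrableOn (fun s => g (i.insertNth (y s) s)) (simplexDomain n) := by
    intro y hy hys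
    refine ContinuousOn.integrableOn_compact (isCompact_simplexDomain n) ?_
    refine hg.continuousOn.comp (hcc y hy).continuousOn fun s hs => hDV ?_
    exact (insertNth_mem_simplexDomain_iff i _ s).2 ⟨hs, hys s hs⟩
  rw [setIntegral_simplexDomain_succ i (hcont.mono hDV), ← setIntegral_insertNth_eq i,
    ← integral_sub (hinteg _ hsumc fun s hs => ⟨by linarith [hs.2], le_rfl⟩)
      (hinteg (fun _ => 0) continuous_const fun s hs => ⟨le_rfl, by linarith [hs.2]⟩)]
  refine setIntegral_congr_fun (isClosed_simplexDomain n).measurableSet fun s hs => ?_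
  have h01 : (0 : ℝ) ≤ 1 - ∑ j, s j := by linarith [hs.2]
  have hmem : ∀ x ∈ Set.uIcc 0 (1 - ∑ j, s j), (i.insertNth x s : Fin (n + 1) → ℝ) ∈ V := by
    intro x hx
    rw [Set.uIcc_of_le h01] at hx
    exact hDV ((insertNth_mem_simplexDomain_iff i x s).2 ⟨hs, hx⟩)
  refine intervalIntegral.integral_eq_sub_of_hasDerivAt
    (f := fun x => g (i.insertNth x s)) (fun x hx => ?_) ?_
  · have h1 : HasFDerivAt g (fderivWithin ℝ g V (i.insertNth x s)) (i.insertNth x s) :=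
      ((hg.differentiableOn one_ne_zero _ (hmem x hx)).hasFDerivWithinAt).hasFDerivAt
        (hV.mem_nhds (hmem x hx))
    exact h1.comp_hasDerivAt x (hins s x)
  · refine ContinuousOn.intervalIntegrable ?_
    refine hcont.comp (fun x _ => (hins s x).continuousAt.continuousWithinAt) hmem

end Simplex

/-! ### Stokes' formula in the parameter domain, and the face maps. -/

section SimplexForms

open MeasureTheory

variable {n : ℕ}

/-- Evaluation of an alternating map on the edges `eⱼ - e₀` of the standard simplex. -/
theorem ContinuousAlternatingMap.apply_edges
    (η : (Fin (n + 1) → ℝ) [⋀^Fin n]→L[ℝ] ℝ) :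
    η (fun l => Pi.single l.succ 1 - Pi.single 0 1) =
      ∑ i : Fin (n + 1), (-1) ^ (i : ℕ) * η (fun l => Pi.single (i.succAbove l) 1) := by
  -- Let `ζ = s ∧ η`, where `s` is the sum of the coordinates. Since `s` kills every edge and is `1`
  -- on every basis vector, the left side is `ζ(e₀, edges)` and the right side is `ζ` on the
  -- standard basis. The matrix relating the two families is unitriangular.
  let s : (Fin (n + 1) → ℝ) →L[ℝ] ℝ := ∑ i, ContinuousLinearMap.proj i
  let ζ : (Fin (n + 1) → ℝ) [⋀^Fin (n + 1)]→L[ℝ] ℝ :=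
    ContinuousAlternatingMap.alternatizeUncurryFin (s.smulRight η)
  have hζ : ∀ v, ζ v = ∑ i : Fin (n + 1), (-1) ^ (i : ℕ) * (s (v i) * η (i.removeNth v)) := by
    intro v
    simp [ζ, ContinuousAlternatingMap.alternatizeUncurryFin_apply]
  have hs : ∀ i, s (Pi.single i 1) = 1 := by intro i; simp [s]
  let e : Fin (n + 1) → Fin (n + 1) → ℝ := fun i => Pi.single i 1
  let v : Fin (n + 1) → Fin (n + 1) → ℝ :=
    Fin.cons (Pi.single 0 1) fun l => Pi.single l.succ 1 - Pi.single 0 1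
  have h1 : ζ v = η (fun l => Pi.single l.succ 1 - Pi.single 0 1) := by
    rw [hζ, Fin.sum_univ_succ, Finset.sum_eq_zero, add_zero]
    · have : Fin.removeNth 0 v = fun l : Fin n => Pi.single l.succ 1 - Pi.single 0 1 := by
        funext l; simp [v, Fin.removeNth_apply]
      rw [this]
      simp [v, hs]
    · intro l _
      simp [v, map_sub, hs]
  have h2 : ζ e = ∑ i : Fin (n + 1), (-1) ^ (i : ℕ) * η (fun l => Pi.single (i.succAbove l) 1) := by
    rw [hζ]
    refine Finset.sum_congr rfl fun i _ => ?_
    rw [show s (e i) = 1 from hs i, one_mul]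
    rfl
  rw [← h1, ← h2]
  have h3 := ContinuousAlternatingMap.eq_apply_basis_mul_det (Pi.basisFun ℝ (Fin (n + 1))) ζ v
  have he : (Pi.basisFun ℝ (Fin (n + 1)) : Fin (n + 1) → Fin (n + 1) → ℝ) = e := by
    funext i; simp [e]
  have hdet : (Pi.basisFun ℝ (Fin (n + 1))).det v = 1 := by
    rw [Pi.basisFun_det_apply, Matrix.det_of_isLowerTriangular]
    · refine Finset.prod_eq_one fun i _ => ?_
      refine Fin.cases ?_ (fun l => ?_) i
      · simp [v]
      · simp [v]
    · intro i j hij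
      have hij' : i < j := hij
      revert hij'
      refine Fin.cases ?_ (fun l => ?_) i
      · intro h
        simp [v, h.ne']
      · intro h
        have h0 : j ≠ 0 := fun h0 => by simp [h0] at h
        simp [v, h.ne', h0]
  rw [h3, he, hdet, mul_one]

/-- Stokes' theorem for a form on a neighbourhood of the standard simplex. -/
theorem integral_extDerivWithin_simplexDomain {V : Set (Fin (n + 1) → ℝ)} (hV : IsOpen V)
    (hDV : simplexDomain (n + 1) ⊆ V)
    {η : (Fin (n + 1) → ℝ) → (Fin (n + 1) → ℝ) [⋀^Fin n]→L[ℝ] ℝ} (hη : ContDiffOn ℝ 1 η V) :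
    ∫ t in simplexDomain (n + 1), extDerivWithin η V t (fun i => Pi.single i 1) =
      (∫ s in simplexDomain n,
        η (Fin.cons (1 - ∑ j, s j) s) fun l => Pi.single l.succ 1 - Pi.single 0 1) +
      ∑ i : Fin (n + 1), (-1) ^ ((i : ℕ) + 1) *
        ∫ s in simplexDomain n, η (i.insertNth 0 s) fun l => Pi.single (i.succAbove l) 1 := by
  let g : Fin (n + 1) → (Fin (n + 1) → ℝ) → ℝ := fun i t => η t fun l => Pi.single (i.succAbove l) 1
  have hg : ∀ i, ContDiffOn ℝ 1 (g i) V := fun i =>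
    (ContinuousAlternatingMap.apply ℝ (Fin (n + 1) → ℝ) ℝ
      fun l => Pi.single (i.succAbove l) 1).contDiff.comp_contDiffOn hη
  have hint : ∀ i, IntegrableOn (fun t => fderivWithin ℝ (g i) V t (Pi.single i 1))
      (simplexDomain (n + 1)) := fun i =>
    ContinuousOn.integrableOn_compact (isCompact_simplexDomain _)
      ((((hg i).continuousOn_fderivWithin hV.uniqueDiffOn le_rfl).clm_apply
        continuousOn_const).mono hDV)
  have hcons : Continuous fun s : Fin n → ℝ =>
      (Fin.cons (1 - ∑ j, s j) s : Fin (n + 1) → ℝ) := by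
    rw [continuous_pi_iff]
    refine Fin.cases ?_ fun l => ?_
    · simp only [Fin.cons_zero]; fun_prop
    · simpa using continuous_apply l
  have hint' : ∀ i, IntegrableOn (fun s : Fin n → ℝ => g i (Fin.cons (1 - ∑ j, s j) s))
      (simplexDomain n) := by
    intro i
    refine ContinuousOn.integrableOn_compact (isCompact_simplexDomain _) ?_
    refine (hg i).continuousOn.comp hcons.continuousOn fun s hs => hDV ?_
    have := (insertNth_mem_simplexDomain_iff 0 (1 - ∑ j, s j) s).2
      ⟨hs, by linarith [hs.2], le_rfl⟩
    rwa [Fin.insertNth_zero'] at this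
  have h1 : ∀ t ∈ simplexDomain (n + 1), extDerivWithin η V t (fun i => Pi.single i 1) =
      ∑ i : Fin (n + 1), (-1) ^ (i : ℕ) * fderivWithin ℝ (g i) V t (Pi.single i 1) := by
    intro t ht
    rw [extDerivWithin_apply (hη.differentiableOn one_ne_zero t (hDV ht))
      (hV.uniqueDiffOn t (hDV ht))]
    refine Finset.sum_congr rfl fun i _ => ?_
    rw [zsmul_eq_mul]
    push_cast
    rfl
  rw [setIntegral_congr_fun (isClosed_simplexDomain _).measurableSet h1,
    integral_finsetSum _ fun i _ => (hint i).const_mul _]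
  -- Each partial derivative contributes an oblique-face term and a coordinate-face term. By
  -- `ContinuousAlternatingMap.apply_edges`, the oblique terms add up to the single integral of `η`
  -- on the edges.
  simp only [integral_const_mul, integral_partial_simplexDomain _ hV hDV (hg _),
    ContinuousAlternatingMap.apply_edges]
  rw [integral_finsetSum _ fun i _ => (hint' i).const_mul _, ← Finset.sum_add_distrib]
  refine Finset.sum_congr rfl fun i _ => ?_
  rw [integral_const_mul, pow_succ]
  ring

/-- The inclusion of the `i`-th face in the parameter domain of the standard simplex. -/
def simplexFaceMap (i : Fin (n + 2)) (s : Fin n → ℝ) : Fin (n + 1) → ℝ :=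
  Fin.tail (i.insertNth 0 (simplexParam n s) : Fin (n + 2) → ℝ)

theorem simplexFaceMap_zero (s : Fin n → ℝ) :
    simplexFaceMap 0 s = Fin.cons (1 - ∑ j, s j) s := by
  rw [simplexFaceMap, Fin.insertNth_zero', Fin.tail_cons]
  rfl

theorem simplexFaceMap_succ (i : Fin (n + 1)) (s : Fin n → ℝ) :
    simplexFaceMap i.succ s = i.insertNth 0 s := by
  funext j
  rw [simplexFaceMap, simplexParam, Fin.insertNth_succ_cons, Fin.tail_cons]

theorem sum_simplexParam (s : Fin n → ℝ) : ∑ j, simplexParam n s j = 1 := by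
  simp [simplexParam, Fin.sum_univ_succ]

theorem simplexParam_faceMap (i : Fin (n + 2)) (s : Fin n → ℝ) :
    simplexParam (n + 1) (simplexFaceMap i s) = i.insertNth 0 (simplexParam n s) := by
  set t : Fin (n + 2) → ℝ := i.insertNth 0 (simplexParam n s) with ht
  have h1 : ∑ j, t j = 1 := by
    rw [Fin.sum_univ_succAbove _ i]
    simp [ht, sum_simplexParam]
  have h2 : 1 - ∑ j, Fin.tail t j = t 0 := by
    rw [Fin.sum_univ_succ] at h1
    simp only [Fin.tail]
    linarith
  rw [simplexParam, simplexFaceMap, ← ht, h2, Fin.cons_self_tail]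

theorem simplexParam_mem_stdSimplex {t : Fin n → ℝ} (ht : t ∈ simplexDomain n) :
    simplexParam n t ∈ stdSimplex ℝ (Fin (n + 1)) := by
  refine ⟨fun i => ?_, sum_simplexParam t⟩
  refine Fin.cases ?_ (fun l => ?_) i
  · simpa [simplexParam] using ht.2
  · simpa [simplexParam] using ht.1 l

theorem exists_simplexParam_eq {x : Fin (n + 1) → ℝ} (hx : x ∈ stdSimplex ℝ (Fin (n + 1))) :
    ∃ t ∈ simplexDomain n, simplexParam n t = x := by
  have h1 := hx.2
  rw [Fin.sum_univ_succ] at h1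
  refine ⟨Fin.tail x, ⟨fun i => hx.1 _, ?_⟩, ?_⟩
  · have := hx.1 0
    simp only [Fin.tail]
    linarith
  · have h2 : 1 - ∑ j, Fin.tail x j = x 0 := by
      simp only [Fin.tail]
      linarith
    rw [simplexParam, h2, Fin.cons_self_tail]

theorem FunOnFinite.linearMap_succAbove (i : Fin (n + 2)) (x : Fin (n + 1) → ℝ) :
    FunOnFinite.linearMap ℝ ℝ (Fin.succAbove i) x = i.insertNth 0 x := by
  funext j
  rw [FunOnFinite.linearMap_apply_apply]
  revert j
  rw [Fin.forall_iff_succAbove i]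
  refine ⟨?_, fun l => ?_⟩
  · simp [Fin.succAbove_ne]
  · simp [Finset.filter_eq']

theorem simplexFaceMap_mem {i : Fin (n + 2)} {s : Fin n → ℝ} (hs : s ∈ simplexDomain n) :
    simplexFaceMap i s ∈ simplexDomain (n + 1) := by
  refine Fin.cases ?_ (fun i => ?_) i
  · rw [simplexFaceMap_zero, ← Fin.insertNth_zero', insertNth_mem_simplexDomain_iff]
    exact ⟨hs, by linarith [hs.2], le_rfl⟩
  · rw [simplexFaceMap_succ, insertNth_mem_simplexDomain_iff]
    exact ⟨hs, le_rfl, by linarith [hs.2]⟩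

/-- The images of the coordinate vectors under the differential of `simplexFaceMap i`. -/
def simplexFaceFrame (i : Fin (n + 2)) (l : Fin n) : Fin (n + 1) → ℝ :=
  Fin.cases (Pi.single l.succ 1 - Pi.single 0 1) (fun i => Pi.single (i.succAbove l) 1) i

theorem hasFDerivAt_simplexParam (t : Fin n → ℝ) :
    ∃ L : (Fin n → ℝ) →L[ℝ] (Fin (n + 1) → ℝ), HasFDerivAt (simplexParam n) L t ∧
      ∀ j, L (Pi.single j 1) = simplexFrame n j := by
  have h : ∀ i : Fin (n + 1), HasFDerivAt (fun s => simplexParam n s i)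
      ((Fin.cons (-∑ j, ContinuousLinearMap.proj j) fun j => ContinuousLinearMap.proj j :
        Fin (n + 1) → ((Fin n → ℝ) →L[ℝ] ℝ)) i) t := by
    refine Fin.cases ?_ fun l => ?_
    · simp only [simplexParam, Fin.cons_zero]
      have := (HasFDerivAt.fun_sum (u := Finset.univ) fun (j : Fin n) _ =>
        (ContinuousLinearMap.proj (R := ℝ) (φ := fun _ : Fin n => ℝ) j).hasFDerivAt (x := t))
      simpa using this.const_sub 1
    · simp only [simplexParam, Fin.cons_succ]
      exact (ContinuousLinearMap.proj (R := ℝ) (φ := fun _ : Fin n => ℝ) l).hasFDerivAt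
  refine ⟨ContinuousLinearMap.pi _, hasFDerivAt_pi.2 h, fun j => ?_⟩
  funext i
  refine Fin.cases ?_ (fun l => ?_) i
  · simp [simplexFrame]
  · simp [simplexFrame, Pi.single_apply, Fin.succ_inj]

theorem contDiff_simplexParam : ContDiff ℝ ∞ (simplexParam n) := by
  rw [contDiff_pi]
  refine Fin.cases ?_ fun l => ?_
  · simp only [simplexParam, Fin.cons_zero]; fun_prop
  · simp only [simplexParam, Fin.cons_succ]; fun_prop

theorem hasFDerivAt_simplexFaceMap (i : Fin (n + 2)) (s : Fin n → ℝ) :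
    ∃ L : (Fin n → ℝ) →L[ℝ] (Fin (n + 1) → ℝ), HasFDerivAt (simplexFaceMap i) L s ∧
      ∀ j, L (Pi.single j 1) = simplexFaceFrame i j := by
  refine Fin.cases ?_ (fun i => ?_) i
  · have h : (simplexFaceMap 0 : (Fin n → ℝ) → _) = simplexParam n := by
      funext s; rw [simplexFaceMap_zero]; rfl
    rw [h]
    exact hasFDerivAt_simplexParam s
  · have h : ∀ j : Fin (n + 1), HasFDerivAt (fun s => simplexFaceMap i.succ s j)
        ((i.insertNth 0 (fun j => ContinuousLinearMap.proj j) :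
          Fin (n + 1) → ((Fin n → ℝ) →L[ℝ] ℝ)) j) s := by
      simp only [simplexFaceMap_succ]
      rw [Fin.forall_iff_succAbove i]
      refine ⟨?_, fun l => ?_⟩
      · simpa using hasFDerivAt_const (0 : ℝ) s
      · simp only [Fin.insertNth_apply_succAbove]
        exact (ContinuousLinearMap.proj (R := ℝ) (φ := fun _ : Fin n => ℝ) l).hasFDerivAt
    refine ⟨ContinuousLinearMap.pi _, hasFDerivAt_pi.2 h, fun j => ?_⟩
    funext l
    revert l
    rw [Fin.forall_iff_succAbove i]
    refine ⟨?_, fun l => ?_⟩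
    · simp [simplexFaceFrame, (Fin.succAbove_ne i j).symm]
    · simp [simplexFaceFrame, Pi.single_apply]

theorem contDiff_simplexFaceMap (i : Fin (n + 2)) : ContDiff ℝ ∞ (simplexFaceMap (n := n) i) := by
  have h : ContDiff ℝ ∞ fun s : Fin n → ℝ =>
      (i.insertNth 0 (simplexParam n s) : Fin (n + 2) → ℝ) := by
    rw [contDiff_pi, Fin.forall_iff_succAbove i]
    refine ⟨by simpa using contDiff_const, fun j => ?_⟩
    simp only [Fin.insertNth_apply_succAbove]
    exact contDiff_pi.1 contDiff_simplexParam j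
  rw [contDiff_pi] at h ⊢
  exact fun j => h j.succ

end SimplexForms

/-! ### Stokes' theorem for smooth singular chains and the de Rham pairing -/

section Stokes

open MeasureTheory Topology

variable {E : Type*} [NormedAddCommGroup E] [NormedSpace ℝ E]
  {H : Type*} [TopologicalSpace H] {I : ModelWithCorners ℝ E H}
  {M : Type*} [TopologicalSpace M] [ChartedSpace H M]
  {E' E'' : Type*} [NormedAddCommGroup E'] [NormedSpace ℝ E']
  [NormedAddCommGroup E''] [NormedSpace ℝ E''] {n k : ℕ}

/-- At interior points the pullback depends only on the germ of the map. This is what makes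
integrals independent of the chosen extension of a simplex. -/
theorem DiffForm.pullbackWithin_congr (θ : DiffForm I M k) {f f' : E' → M} {s s' : Set E'} {y : E'}
    (h : f =ᶠ[𝓝 y] f') (hs : s ∈ 𝓝 y) (hs' : s' ∈ 𝓝 y) :
    θ.pullbackWithin f s y = θ.pullbackWithin f' s' y := by
  ext v
  have h1 : (mfderivWithin 𝓘(ℝ, E') I f s y : E' →L[ℝ] E) =
      (mfderivWithin 𝓘(ℝ, E') I f' s' y : E' →L[ℝ] E) := by
    rw [mfderivWithin_of_mem_nhds hs, mfderivWithin_of_mem_nhds hs']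
    exact h.mfderiv_eq
  have aux : ∀ x x' : M, x = x' → ∀ w : Fin k → E,
      (θ x : E [⋀^Fin k]→L[ℝ] ℝ) w = (θ x' : E [⋀^Fin k]→L[ℝ] ℝ) w := by
    rintro x _ rfl w; rfl
  refine (aux _ _ h.self_of_nhds _).trans ?_
  exact congrArg (fun L : E' →L[ℝ] E => (θ (f' y) : E [⋀^Fin k]→L[ℝ] ℝ) fun i => L (v i)) h1

theorem DiffForm.pullbackWithin_comp_apply (θ : DiffForm I M k) {f : E' → M} {V : Set E'}
    (hV : IsOpen V) {g : E'' → E'} {L : E'' →L[ℝ] E'} {y : E''} (hg : HasFDerivAt g L y)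
    {s : Set E''} (hs : s ∈ 𝓝 y) (hy : g y ∈ V) (hf : MDifferentiableAt 𝓘(ℝ, E') I f (g y))
    (v : Fin k → E'') :
    θ.pullbackWithin (f ∘ g) s y v = θ.pullbackWithin f V (g y) fun i => L (v i) := by
  have h1 : (mfderivWithin 𝓘(ℝ, E'') I (f ∘ g) s y : E'' →L[ℝ] E) =
      (mfderivWithin 𝓘(ℝ, E') I f V (g y) : E' →L[ℝ] E).comp L := by
    rw [mfderivWithin_of_mem_nhds hs, mfderivWithin_of_mem_nhds (hV.mem_nhds hy)]
    exact (hf.hasMFDerivAt.comp y hg.hasMFDerivAt).mfderiv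
  exact congrArg (fun L : E'' →L[ℝ] E => (θ (f (g y)) : E [⋀^Fin k]→L[ℝ] ℝ) fun i => L (v i)) h1

/-- The standard frame of `ℝⁿ`. -/
abbrev stdFrame (n : ℕ) (i : Fin n) : Fin n → ℝ := Pi.single i 1

namespace SmoothSimplex

/-- A smooth simplex, extended and parametrized by an open subset of `ℝⁿ`. -/
def param (σ : SmoothSimplex I M n) : (Fin n → ℝ) → M := σ.extension ∘ simplexParam n

/-- An open set on which `param` is smooth. -/
def paramDomain (σ : SmoothSimplex I M n) : Set (Fin n → ℝ) :=
  simplexParam n ⁻¹' σ.2.choose_spec.choose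

variable (σ : SmoothSimplex I M n)

theorem isOpen_paramDomain : IsOpen σ.paramDomain :=
  σ.2.choose_spec.choose_spec.1.preimage contDiff_simplexParam.continuous

theorem simplexDomain_subset_paramDomain : simplexDomain n ⊆ σ.paramDomain := fun _ ht =>
  σ.2.choose_spec.choose_spec.2.1 (simplexParam_mem_stdSimplex ht)

theorem mdifferentiableAt_extension {t : Fin n → ℝ} (ht : t ∈ σ.paramDomain) :
    MDifferentiableAt 𝓘(ℝ, Fin (n + 1) → ℝ) I σ.extension (simplexParam n t) :=
  (σ.2.choose_spec.choose_spec.2.2.1.contMDiffAt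
    (σ.2.choose_spec.choose_spec.1.mem_nhds ht)).mdifferentiableAt (by simp)

theorem contMDiffOn_param : ContMDiffOn 𝓘(ℝ, Fin n → ℝ) I ∞ σ.param σ.paramDomain :=
  σ.2.choose_spec.choose_spec.2.2.1.comp contDiff_simplexParam.contMDiff.contMDiffOn
    fun _ ht => ht

theorem param_apply {t : Fin n → ℝ} (ht : t ∈ simplexDomain n) :
    σ.param t = σ.1 ⟨simplexParam n t, simplexParam_mem_stdSimplex ht⟩ :=
  σ.2.choose_spec.choose_spec.2.2.2 ⟨simplexParam n t, simplexParam_mem_stdSimplex ht⟩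

theorem pullbackDensity_eq (θ : DiffForm I M n) {t : Fin n → ℝ} (ht : t ∈ σ.paramDomain) :
    σ.pullbackDensity θ t = θ.pullbackWithin σ.param σ.paramDomain t (stdFrame n) := by
  obtain ⟨L, hL, hLe⟩ := hasFDerivAt_simplexParam t
  refine Eq.symm ((θ.pullbackWithin_comp_apply (f := σ.extension) isOpen_univ hL
    (σ.isOpen_paramDomain.mem_nhds ht) (Set.mem_univ _) (σ.mdifferentiableAt_extension ht)
      (stdFrame n)).trans ?_)
  simp only [stdFrame, hLe]
  rw [pullbackDensity, DiffForm.pullbackWithin, mfderivWithin_univ]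
  rfl

/-- The integral of a form over a simplex can be computed with any extension of the simplex. -/
theorem integral_eq (θ : DiffForm I M n) {F : (Fin n → ℝ) → M} {V : Set (Fin n → ℝ)}
    (hV : simplexDomain n ⊆ V) (hF : ∀ t ∈ simplexDomain n, F t = σ.param t) :
    σ.integral θ = ∫ t in simplexDomain n, θ.pullbackWithin F V t (stdFrame n) := by
  refine integral_congr_ae ?_
  -- The frontier of a convex set is null, and at interior points the two extensions agree on a
  -- neighbourhood, hence so do their derivatives.
  filter_upwards [ae_mem_interior_simplexDomain n] with t ht
  have hD : simplexDomain n ∈ 𝓝 t := mem_interior_iff_mem_nhds.1 ht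
  rw [σ.pullbackDensity_eq θ (σ.simplexDomain_subset_paramDomain (interior_subset ht))]
  refine congrArg (fun ζ : (Fin n → ℝ) [⋀^Fin n]→L[ℝ] ℝ => ζ (stdFrame n)) ?_
  refine θ.pullbackWithin_congr ?_
    (σ.isOpen_paramDomain.mem_nhds (σ.simplexDomain_subset_paramDomain (interior_subset ht)))
    (Filter.mem_of_superset hD hV)
  filter_upwards [hD] with s hs using (hF s hs).symm

theorem face_param (σ : SmoothSimplex I M (n + 1)) (i : Fin (n + 2)) {s : Fin n → ℝ}
    (hs : s ∈ simplexDomain n) : (σ.face i).param s = σ.param (simplexFaceMap i s) := by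
  rw [param_apply _ hs, param_apply _ (simplexFaceMap_mem hs)]
  change σ.1 _ = σ.1 _
  refine congrArg σ.1 (Subtype.ext ?_)
  change FunOnFinite.linearMap ℝ ℝ (Fin.succAbove i) (simplexParam n s) =
    simplexParam (n + 1) (simplexFaceMap i s)
  rw [FunOnFinite.linearMap_succAbove, simplexParam_faceMap]

variable [IsManifold I ∞ M]

theorem contDiffOn_pullbackWithin {θ : DiffForm I M k} (hθ : θ ∈ smoothForms I M k) :
    ContDiffOn ℝ ∞ (θ.pullbackWithin σ.param σ.paramDomain) σ.paramDomain :=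
  DiffForm.contDiffOn_pullbackWithin hθ σ.contMDiffOn_param σ.isOpen_paramDomain.uniqueDiffOn

theorem continuousOn_pullbackDensity {θ : DiffForm I M n} (hθ : θ ∈ smoothForms I M n) :
    ContinuousOn (σ.pullbackDensity θ) (simplexDomain n) := by
  refine (((ContinuousAlternatingMap.apply ℝ (Fin n → ℝ) ℝ (stdFrame n)).continuous.comp_continuousOn
    (σ.contDiffOn_pullbackWithin hθ).continuousOn).mono
      σ.simplexDomain_subset_paramDomain).congr fun t ht => ?_
  exact σ.pullbackDensity_eq θ (σ.simplexDomain_subset_paramDomain ht)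

theorem integrableOn_pullbackDensity {θ : DiffForm I M n} (hθ : θ ∈ smoothForms I M n) :
    IntegrableOn (σ.pullbackDensity θ) (simplexDomain n) :=
  (σ.continuousOn_pullbackDensity hθ).integrableOn_compact (isCompact_simplexDomain n)

theorem integral_add {θ η : DiffForm I M n} (hθ : θ ∈ smoothForms I M n)
    (hη : η ∈ smoothForms I M n) : σ.integral (θ + η) = σ.integral θ + σ.integral η :=
  MeasureTheory.integral_add (σ.integrableOn_pullbackDensity hθ) (σ.integrableOn_pullbackDensity hη)

/-- The extension chosen for a face is unrelated to the one chosen for `σ`. Since any extension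
computes the integral, the restriction of `σ.param` may be used. -/
theorem face_integral (σ : SmoothSimplex I M (n + 1)) (i : Fin (n + 2)) (θ : DiffForm I M n) :
    (σ.face i).integral θ = ∫ s in simplexDomain n,
      θ.pullbackWithin σ.param σ.paramDomain (simplexFaceMap i s) (simplexFaceFrame i) := by
  rw [(σ.face i).integral_eq θ (F := σ.param ∘ simplexFaceMap i)
    (V := simplexFaceMap i ⁻¹' σ.paramDomain)
    (fun s hs => σ.simplexDomain_subset_paramDomain (simplexFaceMap_mem hs))
    fun s hs => (σ.face_param i hs).symm]
  refine setIntegral_congr_fun (isClosed_simplexDomain n).measurableSet fun s hs => ?_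
  obtain ⟨L, hL, hLe⟩ := hasFDerivAt_simplexFaceMap i s
  have hmem := σ.simplexDomain_subset_paramDomain (simplexFaceMap_mem (i := i) hs)
  refine (θ.pullbackWithin_comp_apply σ.isOpen_paramDomain hL
    ((σ.isOpen_paramDomain.preimage (contDiff_simplexFaceMap i).continuous).mem_nhds hmem) hmem
    ((σ.contMDiffOn_param.contMDiffAt (σ.isOpen_paramDomain.mem_nhds hmem)).mdifferentiableAt
      (by simp)) (stdFrame n)).trans ?_
  simp only [stdFrame, hLe]

/-- Stokes' theorem for a smooth singular simplex. -/
theorem integral_extD (σ : SmoothSimplex I M (n + 1)) (θ : smoothForms I M n) :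
    σ.integral (extD I M n θ) = ∑ i : Fin (n + 2), (-1) ^ (i : ℕ) * (σ.face i).integral θ.1 := by
  have h1 : σ.integral (extD I M n θ) = ∫ t in simplexDomain (n + 1),
      extDerivWithin (DiffForm.pullbackWithin θ.1 σ.param σ.paramDomain) σ.paramDomain t
        (stdFrame (n + 1)) := by
    refine setIntegral_congr_fun (isClosed_simplexDomain _).measurableSet fun t ht => ?_
    have ht' := σ.simplexDomain_subset_paramDomain ht
    rw [σ.pullbackDensity_eq _ ht',
      DiffForm.extDeriv_pullbackWithin θ σ.isOpen_paramDomain σ.contMDiffOn_param ht']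
  rw [h1, integral_extDerivWithin_simplexDomain σ.isOpen_paramDomain
    σ.simplexDomain_subset_paramDomain ((σ.contDiffOn_pullbackWithin θ.2).of_le (by simp))]
  -- In the parameter domain face `0` is the oblique face, and face `i + 1` is the coordinate face
  -- `tᵢ = 0`; this accounts for the exponent `i + 1` in the sign.
  refine Eq.symm ((Fin.sum_univ_succ _).trans ?_)
  simp only [face_integral, simplexFaceMap_zero, simplexFaceMap_succ, Fin.val_succ, Fin.val_zero,
    pow_zero, one_mul]
  rfl

end SmoothSimplex

variable {R : Type*} [CommRing R] [Algebra R ℝ]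

theorem chainIntegral_add (θ : DiffForm I M n) (c d : SmoothChain I M R n) :
    chainIntegral θ (c + d) = chainIntegral θ c + chainIntegral θ d :=
  Finsupp.sum_add_index' (by simp) (by simp [add_mul])

theorem chainIntegral_zero (θ : DiffForm I M n) :
    chainIntegral θ (0 : SmoothChain I M R n) = 0 := Finsupp.sum_zero_index

theorem chainIntegral_single (θ : DiffForm I M n) (σ : SmoothSimplex I M n) (r : R) :
    chainIntegral θ (Finsupp.single σ r) = algebraMap R ℝ r * σ.integral θ :=
  Finsupp.sum_single_index (by simp)

theorem chainIntegral_finset_sum {ι : Type*} (s : Finset ι) (θ : DiffForm I M n)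
    (c : ι → SmoothChain I M R n) :
    chainIntegral θ (∑ i ∈ s, c i) = ∑ i ∈ s, chainIntegral θ (c i) := by
  classical
  induction s using Finset.induction_on with
  | empty => exact chainIntegral_zero θ
  | insert a s ha ih => rw [Finset.sum_insert ha, Finset.sum_insert ha, chainIntegral_add, ih]

theorem chainIntegral_sub (θ : DiffForm I M n) (c d : SmoothChain I M R n) :
    chainIntegral θ (c - d) = chainIntegral θ c - chainIntegral θ d := by
  rw [eq_sub_iff_add_eq, ← chainIntegral_add, sub_add_cancel]

theorem chainIntegral_zero_form (c : SmoothChain I M R n) :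
    chainIntegral (0 : DiffForm I M n) c = 0 := by
  simp [chainIntegral, SmoothSimplex.integral, SmoothSimplex.pullbackDensity]

variable [IsManifold I ∞ M]

theorem chainIntegral_add_form {θ η : DiffForm I M n} (hθ : θ ∈ smoothForms I M n)
    (hη : η ∈ smoothForms I M n) (c : SmoothChain I M R n) :
    chainIntegral (θ + η) c = chainIntegral θ c + chainIntegral η c := by
  simp only [chainIntegral, SmoothSimplex.integral_add _ hθ hη, mul_add]
  exact Finsupp.sum_add

theorem chainIntegral_sum_form {ι : Type*} (s : Finset ι) {θ : ι → DiffForm I M n}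
    (hθ : ∀ i, θ i ∈ smoothForms I M n) (c : SmoothChain I M R n) :
    chainIntegral (∑ i ∈ s, θ i) c = ∑ i ∈ s, chainIntegral (θ i) c := by
  classical
  induction s using Finset.induction_on with
  | empty => exact chainIntegral_zero_form c
  | insert a s ha ih =>
    rw [Finset.sum_insert ha, Finset.sum_insert ha,
      chainIntegral_add_form (hθ a) (Submodule.sum_mem _ fun i _ => hθ i), ih]

/-- Stokes' theorem for smooth singular chains. -/
theorem chainIntegral_chainBoundary (θ : smoothForms I M n) (c : SmoothChain I M R (n + 1)) :
    chainIntegral θ.1 (chainBoundary I M R n c) = chainIntegral (extD I M n θ) c := by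
  induction c using Finsupp.induction_linear with
  | zero => rw [map_zero, chainIntegral_zero, chainIntegral_zero]
  | add f g hf hg => rw [map_add, chainIntegral_add, chainIntegral_add, hf, hg]
  | single σ r =>
    rw [chainBoundary, Finsupp.linearCombination_single, Finset.smul_sum,
      chainIntegral_finset_sum, chainIntegral_single, SmoothSimplex.integral_extD, Finset.mul_sum]
    refine Finset.sum_congr rfl fun i _ => ?_
    rw [Finsupp.smul_single, chainIntegral_single, smul_eq_mul, map_mul, map_pow, map_neg, map_one,
      mul_assoc]

theorem chainIntegral_chainBoundary_of_closed {θ : smoothForms I M n} (hθ : extD I M n θ = 0)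
    (c : SmoothChain I M R (n + 1)) : chainIntegral θ.1 (chainBoundary I M R n c) = 0 := by
  rw [chainIntegral_chainBoundary, hθ, chainIntegral_zero_form]

theorem chainIntegral_eq_of_mkQ_eq {k : ℕ} {θ : smoothForms I M (k + 1)}
    (hθ : extD I M (k + 1) θ = 0) {c d : smoothCycles I M R k}
    (h : (smoothBoundaries I M R k).mkQ c = (smoothBoundaries I M R k).mkQ d) :
    chainIntegral θ.1 c.1 = chainIntegral θ.1 d.1 := by
  rw [Submodule.mkQ_apply, Submodule.mkQ_apply, Submodule.Quotient.eq] at h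
  obtain ⟨b, hb⟩ := h
  rw [← sub_eq_zero, ← chainIntegral_sub]
  have hb' : chainBoundary I M R (k + 1) b = c.1 - d.1 := hb
  rw [← hb', chainIntegral_chainBoundary_of_closed hθ]

/-- The de Rham pairing is given by integrating any representative over any representative. -/
theorem deRhamPairing_mk {k : ℕ} (β : closedForms I M (k + 1)) (c : smoothCycles I M R k) :
    deRhamPairing (deRhamClass β) ((smoothBoundaries I M R k).mkQ c) =
      chainIntegral β.1.1 c.1 := by
  set a := Quotient.out (deRhamClass β) with ha
  set d := Quotient.out ((smoothBoundaries I M R k).mkQ c) with hd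
  have h1 : (exactForms I M k).mkQ a = (exactForms I M k).mkQ β := Quotient.out_eq _
  have h2 : (smoothBoundaries I M R k).mkQ d = (smoothBoundaries I M R k).mkQ c :=
    Quotient.out_eq _
  have h3 : deRhamPairing (deRhamClass β) ((smoothBoundaries I M R k).mkQ c) =
    chainIntegral a.1.1 d.1 := rfl
  -- The pairing is defined with arbitrary representatives. The cycle is changed first, using
  -- closedness of the form; then the form is changed by an exact one, whose integral over a cycle
  -- vanishes by Stokes.
  rw [h3, chainIntegral_eq_of_mkQ_eq a.2 h2]
  rw [Submodule.mkQ_apply, Submodule.mkQ_apply, Submodule.Quotient.eq] at h1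
  obtain ⟨η, hη⟩ := h1
  have hη' : extD I M k η = a.1.1 - β.1.1 := hη
  have h4 : a.1.1 = (a.1 - β.1).1 + β.1.1 := (sub_add_cancel _ _).symm
  have h5 : chainIntegral (a.1 - β.1).1 c.1 = 0 := by
    have : (a.1 - β.1).1 = extD I M k η := hη'.symm
    rw [this, ← chainIntegral_chainBoundary]
    have hc : chainBoundary I M R k c.1 = 0 := c.2
    rw [hc, chainIntegral_zero]
  rw [h4, chainIntegral_add_form (a.1 - β.1).2 β.1.2, h5, zero_add]

/-! ### Naturality of the integral and of the pairing under smooth maps. -/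

section Push

variable {H' : Type*} [TopologicalSpace H'] {J : ModelWithCorners ℝ E' H'}
  {N : Type*} [TopologicalSpace N] [ChartedSpace H' N]

theorem SmoothSimplex.push_integral (u : C^∞⟮J, N; I, M⟯) (σ : SmoothSimplex J N n)
    (θ : DiffForm I M n) : (σ.push u).integral θ = σ.integral (DiffForm.pullback u θ) := by
  rw [(σ.push u).integral_eq θ (F := u ∘ σ.param) (V := σ.paramDomain)
    σ.simplexDomain_subset_paramDomain fun t ht => by
      rw [param_apply _ ht, Function.comp_apply, param_apply _ ht]; rfl]
  refine setIntegral_congr_fun (isClosed_simplexDomain n).measurableSet fun t ht => ?_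
  have ht' := σ.simplexDomain_subset_paramDomain ht
  rw [σ.pullbackDensity_eq _ ht']
  have h1 : (mfderivWithin 𝓘(ℝ, Fin n → ℝ) I (u ∘ σ.param) σ.paramDomain t :
      (Fin n → ℝ) →L[ℝ] E) = (mfderiv J I u (σ.param t) : E' →L[ℝ] E).comp
        (mfderivWithin 𝓘(ℝ, Fin n → ℝ) J σ.param σ.paramDomain t) :=
    mfderiv_comp_mfderivWithin t (u.contMDiff.mdifferentiableAt (by simp))
      ((σ.contMDiffOn_param t ht').mdifferentiableWithinAt (by simp))
      (σ.isOpen_paramDomain.uniqueDiffOn t ht').uniqueMDiffWithinAt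
  exact congrArg (fun L : (Fin n → ℝ) →L[ℝ] E =>
    (θ (u (σ.param t)) : E [⋀^Fin n]→L[ℝ] ℝ) fun i => L (stdFrame n i)) h1

theorem chainIntegral_pushChain (u : C^∞⟮J, N; I, M⟯) (θ : DiffForm I M n)
    (c : SmoothChain J N R n) :
    chainIntegral θ (pushChain R u n c) = chainIntegral (DiffForm.pullback u θ) c := by
  induction c using Finsupp.induction_linear with
  | zero => rw [map_zero, chainIntegral_zero, chainIntegral_zero]
  | add f g hf hg => rw [map_add, chainIntegral_add, chainIntegral_add, hf, hg]
  | single σ r =>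
    rw [pushChain, Finsupp.lmapDomain_apply, Finsupp.mapDomain_single, chainIntegral_single,
      chainIntegral_single, SmoothSimplex.push_integral]

theorem deRhamPairing_pushHomology (u : C^∞⟮J, N; I, M⟯) {k : ℕ} (β : closedForms I M (k + 1))
    (c : smoothCycles J N R k) :
    deRhamPairing (deRhamClass β) (pushHomology u ((smoothBoundaries J N R k).mkQ c)) =
      chainIntegral (DiffForm.pullback u β.1.1) c.1 := by
  have h1 : pushHomology u ((smoothBoundaries J N R k).mkQ c) =
    (smoothBoundaries I M R k).mkQ (pushCycle R u k c) := rfl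
  rw [h1, deRhamPairing_mk, ← chainIntegral_pushChain]
  rfl

end Push

end Stokes

/-! ### Integration over a fundamental class -/

section FundamentalClass

open MeasureTheory Topology

namespace SmoothSimplex

section

variable {E : Type*} [NormedAddCommGroup E] [NormedSpace ℝ E]
  {H : Type*} [TopologicalSpace H] {I : ModelWithCorners ℝ E H}
  {M : Type*} [TopologicalSpace M] [ChartedSpace H M] {n : ℕ} (σ : SmoothSimplex I M n)

theorem range_eq_image_param : Set.range σ.1 = σ.param '' simplexDomain n := by
  ext x
  constructor
  · rintro ⟨⟨y, hy⟩, rfl⟩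
    obtain ⟨t, ht, rfl⟩ := exists_simplexParam_eq hy
    exact ⟨t, ht, σ.param_apply ht⟩
  · rintro ⟨t, ht, rfl⟩
    exact ⟨_, (σ.param_apply ht).symm⟩

theorem continuousOn_param : ContinuousOn σ.param (simplexDomain n) :=
  σ.contMDiffOn_param.continuousOn.mono σ.simplexDomain_subset_paramDomain

theorem isCompact_range : IsCompact (Set.range σ.1) := by
  rw [range_eq_image_param]
  exact (isCompact_simplexDomain n).image_of_continuousOn σ.continuousOn_param

theorem injOn_param (hσ : Function.Injective σ.1) : Set.InjOn σ.param (simplexDomain n) := by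
  intro s hs t ht hst
  rw [σ.param_apply hs, σ.param_apply ht] at hst
  have h1 := congrArg Subtype.val (hσ hst)
  funext i
  simpa [simplexParam] using congrFun h1 i.succ

theorem pullbackDensity_eq_zero {θ : DiffForm I M n} {t : Fin n → ℝ} (h : θ (σ.param t) = 0) :
    σ.pullbackDensity θ t = 0 := by
  have h1 : θ (σ.extension (simplexParam n t)) = 0 := h
  rw [pullbackDensity, h1]
  rfl

theorem integral_eq_zero {θ : DiffForm I M n} (h : ∀ z ∈ Set.range σ.1, θ z = 0) :
    σ.integral θ = 0 :=
  setIntegral_eq_zero_of_forall_eq_zero fun t ht => σ.pullbackDensity_eq_zero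
    (h _ (by rw [range_eq_image_param]; exact ⟨t, ht, rfl⟩))

end

variable {n : ℕ} {H : Type*} [TopologicalSpace H]
  {I : ModelWithCorners ℝ (EuclideanSpace ℝ (Fin n)) H}
  {S : Type*} [TopologicalSpace S] [ChartedSpace H S] [IsManifold I ∞ S]
  (σ : SmoothSimplex I S n)

/-- The coordinate expression of `param` in the preferred chart at `p`. -/
def chartMap (p : S) (t : Fin n → ℝ) : Fin n → ℝ :=
  EuclideanSpace.equiv (Fin n) ℝ (extChartAt I p (σ.param t))

theorem contDiffAt_extChartAt_param {p : S} {t : Fin n → ℝ} (ht : t ∈ σ.paramDomain)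
    (hp : σ.param t ∈ (extChartAt I p).source) :
    ContDiffAt ℝ ∞ (extChartAt I p ∘ σ.param) t := by
  rw [← contMDiffAt_iff_contDiffAt]
  rw [extChartAt_source] at hp
  exact (contMDiffAt_extChartAt' hp).comp t
    (σ.contMDiffOn_param.contMDiffAt (σ.isOpen_paramDomain.mem_nhds ht))

theorem contDiffAt_chartMap {p : S} {t : Fin n → ℝ} (ht : t ∈ σ.paramDomain)
    (hp : σ.param t ∈ (extChartAt I p).source) : ContDiffAt ℝ ∞ (σ.chartMap p) t :=
  (EuclideanSpace.equiv (Fin n) ℝ).contDiff.contDiffAt.comp t (σ.contDiffAt_extChartAt_param ht hp)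

/-- The density of `σ^*θ` is the chart coefficient of `θ` times a Jacobian determinant. Both the
inverse function theorem and the change of variables formula are applied through this factorization.
-/
theorem pullbackDensity_eq_coeff_mul_det (θ : DiffForm I S n) {p : S} {t : Fin n → ℝ}
    (ht : t ∈ σ.paramDomain) (hp : σ.param t ∈ (extChartAt I p).source) :
    σ.pullbackDensity θ t =
      θ.coeff p (extChartAt I p (σ.param t)) * (fderiv ℝ (σ.chartMap p) t).det := by
  have hV := σ.isOpen_paramDomain.mem_nhds ht
  have hI : IsManifold I 1 S := IsManifold.of_le (n := ∞) (by simp)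
  have h1 : fderiv ℝ (σ.chartMap p) t =
      ((EuclideanSpace.equiv (Fin n) ℝ : EuclideanSpace ℝ (Fin n) →L[ℝ] Fin n → ℝ)).comp
        (fderiv ℝ (extChartAt I p ∘ σ.param) t) :=
    (EuclideanSpace.equiv (Fin n) ℝ).comp_fderiv
  rw [σ.pullbackDensity_eq θ ht, θ.pullbackWithin_eq p
    ((σ.contMDiffOn_param t ht).mdifferentiableWithinAt (by simp))
    (σ.isOpen_paramDomain.uniqueDiffOn t ht) hp, fderivWithin_of_mem_nhds hV]
  have h2 : ⇑(EuclideanSpace.basisFun (Fin n) ℝ).toBasis =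
      fun i => (EuclideanSpace.single i 1 : EuclideanSpace ℝ (Fin n)) := by
    funext i
    simp
  have h3 : θ.inChart p (extChartAt I p (σ.param t)) (EuclideanSpace.basisFun (Fin n) ℝ).toBasis =
      θ.coeff p (extChartAt I p (σ.param t)) := by
    rw [h2]
    rfl
  have h4 : (EuclideanSpace.basisFun (Fin n) ℝ).toBasis.det
      (fun i => fderiv ℝ (extChartAt I p ∘ σ.param) t (stdFrame n i)) =
      (fderiv ℝ (σ.chartMap p) t).det := by
    rw [h1, Module.Basis.det_apply, ContinuousLinearMap.det, ← LinearMap.det_toMatrix']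
    congr 1
  exact (ContinuousAlternatingMap.eq_apply_basis_mul_det
    (EuclideanSpace.basisFun (Fin n) ℝ).toBasis (θ.inChart p (extChartAt I p (σ.param t)))
    _).trans (congrArg₂ (· * ·) h3 h4)

/-- A nonzero density forces a nonzero Jacobian, so by the inverse function theorem the image in
chart coordinates is a neighbourhood; continuity and injectivity of the chart carry this back to
`S`. -/
theorem image_param_mem_nhds {θ : DiffForm I S n} {t : Fin n → ℝ} (ht : t ∈ σ.paramDomain)
    (hθ : σ.pullbackDensity θ t ≠ 0) {N : Set (Fin n → ℝ)} (hN : N ∈ 𝓝 t) :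
    σ.param '' N ∈ 𝓝 (σ.param t) := by
  set p := σ.param t with hp
  have hps : σ.param t ∈ (extChartAt I p).source := mem_extChartAt_source p
  rw [σ.pullbackDensity_eq_coeff_mul_det θ ht hps] at hθ
  have hc := σ.contDiffAt_chartMap ht hps
  have hstrict := hc.hasStrictFDerivAt (by simp)
  have hdet : (fderiv ℝ (σ.chartMap p) t).det ≠ 0 := right_ne_zero_of_mul hθ
  rw [← ContinuousLinearMap.coe_toContinuousLinearEquivOfDetNeZero _ hdet] at hstrict
  have hmap := hstrict.map_nhds_eq_of_equiv
  have hcont : ContinuousAt σ.param t :=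
    (σ.contMDiffOn_param.contMDiffAt (σ.isOpen_paramDomain.mem_nhds ht)).continuousAt
  have hsrc : (extChartAt I p).source ∈ 𝓝 p := extChartAt_source_mem_nhds p
  have hN' : N ∩ σ.param ⁻¹' (extChartAt I p).source ∈ 𝓝 t := Filter.inter_mem hN (hcont hsrc)
  have h1 : σ.chartMap p '' (N ∩ σ.param ⁻¹' (extChartAt I p).source) ∈ 𝓝 (σ.chartMap p t) := by
    rw [← hmap]
    exact Filter.image_mem_map hN'
  have h2 : ContinuousAt (fun z => EuclideanSpace.equiv (Fin n) ℝ (extChartAt I p z)) p :=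
    (EuclideanSpace.equiv (Fin n) ℝ).continuous.continuousAt.comp (continuousAt_extChartAt p)
  filter_upwards [h2 h1, hsrc] with z hz hzs
  obtain ⟨s, ⟨hsN, hss⟩, hs⟩ := hz
  exact ⟨s, hsN, (extChartAt I p).injOn hss hzs ((EuclideanSpace.equiv (Fin n) ℝ).injective hs)⟩

theorem isOpen_image_param {θ : DiffForm I S n}
    (hθ : ∀ t ∈ simplexDomain n, σ.pullbackDensity θ t ≠ 0) :
    IsOpen (σ.param '' interior (simplexDomain n)) := by
  rw [isOpen_iff_mem_nhds]
  rintro _ ⟨t, ht, rfl⟩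
  exact σ.image_param_mem_nhds (σ.simplexDomain_subset_paramDomain (interior_subset ht))
    (hθ t (interior_subset ht)) (isOpen_interior.mem_nhds ht)

variable [T2Space S] [CompactSpace S] [RiemannianBundle (fun x : S => TangentSpace I x)]
  (vol : RiemannianVolumeForm I S)

/-- Both integrals reduce to the set `s` of interior parameters sent into the chart at `p`:
elsewhere `θ` or the partition function vanishes. On `s` the coordinate expression of the simplex is
an injective change of variables. -/
theorem integral_chartIntegrand (hσ : Function.Injective σ.1)
    (hpos : ∀ t ∈ simplexDomain n, 0 < σ.pullbackDensity vol.form t) {θ : DiffForm I S n}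
    (h0 : ∀ z, z ∉ σ.param '' interior (simplexDomain n) → θ z = 0) (p : S) :
    ∫ y in (extChartAt I p).target, chartIntegrand vol θ p y =
      ∫ t in simplexDomain n, chartPartition I S p (σ.param t) * σ.pullbackDensity θ t := by
  set T := EuclideanSpace.equiv (Fin n) ℝ with hT
  set s := interior (simplexDomain n) ∩ σ.param ⁻¹' (extChartAt I p).source with hs
  have hsD : s ⊆ simplexDomain n := fun t ht => interior_subset ht.1
  have hsV : s ⊆ σ.paramDomain := hsD.trans σ.simplexDomain_subset_paramDomain
  have hso : IsOpen s := (σ.continuousOn_param.mono interior_subset).isOpen_inter_preimage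
    isOpen_interior (isOpen_extChartAt_source p)
  have hinj : Set.InjOn (σ.chartMap p) s := fun a ha b hb hab =>
    σ.injOn_param hσ (hsD ha) (hsD hb)
      ((extChartAt I p).injOn ha.2 hb.2 (T.injective hab))
  have h1 : ∫ y in (extChartAt I p).target, chartIntegrand vol θ p y =
      ∫ z in T.symm ⁻¹' (extChartAt I p).target, chartIntegrand vol θ p (T.symm z) :=
    ((PiLp.volume_preserving_toLp (Fin n)).setIntegral_preimage_emb
      (MeasurableEquiv.toLp 2 (Fin n → ℝ)).measurableEmbedding _ _).symm
  have hsub : σ.chartMap p '' s ⊆ T.symm ⁻¹' (extChartAt I p).target := by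
    rintro _ ⟨t, ht, rfl⟩
    have h2 : T.symm (σ.chartMap p t) = extChartAt I p (σ.param t) := T.symm_apply_apply _
    rw [Set.mem_preimage, h2]
    exact (extChartAt I p).map_source ht.2
  have hm : MeasurableSet (T.symm ⁻¹' (extChartAt I p).target) :=
    T.symm.continuous.measurable (measurableSet_extChartAt_target p)
  have h2 : ∫ z in T.symm ⁻¹' (extChartAt I p).target, chartIntegrand vol θ p (T.symm z) =
      ∫ z in σ.chartMap p '' s, chartIntegrand vol θ p (T.symm z) := by
    refine (setIntegral_eq_of_subset_of_forall_sdiff_eq_zero hm hsub fun z hz => ?_)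
    have h3 : θ ((extChartAt I p).symm (T.symm z)) = 0 := by
      refine h0 _ ?_
      rintro ⟨t, ht, hte⟩
      refine hz.2 ⟨t, ⟨ht, ?_⟩, ?_⟩
      · rw [Set.mem_preimage, hte]
        exact (extChartAt I p).map_target hz.1
      · rw [chartMap, hte, (extChartAt I p).right_inv hz.1]
        exact T.apply_symm_apply z
    have h4 : DiffForm.coeff θ p (T.symm z) = 0 := by
      rw [DiffForm.coeff, DiffForm.inChart, h3]
      rfl
    rw [chartIntegrand, h4, mul_zero, mul_zero]
  have h3 : ∫ t in simplexDomain n, chartPartition I S p (σ.param t) * σ.pullbackDensity θ t =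
      ∫ t in s, chartPartition I S p (σ.param t) * σ.pullbackDensity θ t := by
    refine setIntegral_eq_of_subset_of_forall_sdiff_eq_zero
      (isClosed_simplexDomain n).measurableSet hsD fun t ht => ?_
    by_cases hti : t ∈ interior (simplexDomain n)
    · have h4 : chartPartition I S p (σ.param t) = 0 := by
        by_contra h5
        refine ht.2 ⟨hti, ?_⟩
        rw [Set.mem_preimage, extChartAt_source]
        exact chartPartition_isSubordinate p (subset_tsupport _ h5)
      rw [h4, zero_mul]
    -- By injectivity on the closed simplex, a frontier point is not sent into the image of the
    -- interior, so `θ` vanishes at its image.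
    · rw [σ.pullbackDensity_eq_zero (h0 _ ?_), mul_zero]
      rintro ⟨t', ht', hte⟩
      exact hti (σ.injOn_param hσ (interior_subset ht') ht.1 hte ▸ ht')
  rw [h1, h2, h3, integral_image_eq_integral_abs_det_fderiv_smul volume hso.measurableSet
    (fun t ht => ((σ.contDiffAt_chartMap (hsV ht) ht.2).differentiableAt
      (by simp)).hasFDerivAt.hasFDerivWithinAt) hinj]
  refine setIntegral_congr_fun hso.measurableSet fun t ht => ?_
  have h4 : T.symm (σ.chartMap p t) = extChartAt I p (σ.param t) := T.symm_apply_apply _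
  have h5 := hpos t (hsD ht)
  rw [σ.pullbackDensity_eq_coeff_mul_det _ (hsV ht) ht.2] at h5
  -- Positivity on the volume form means that its coefficient and the Jacobian have the same sign;
  -- the sign in `integralForm` thus cancels the absolute value in the change of variables.
  have h6 : |(fderiv ℝ (σ.chartMap p) t).det| * Real.sign
      (DiffForm.coeff vol.form p (extChartAt I p (σ.param t))) =
      (fderiv ℝ (σ.chartMap p) t).det := by
    rcases pos_and_pos_or_neg_and_neg_of_mul_pos h5 with ⟨ha, hb⟩ | ⟨ha, hb⟩
    · rw [Real.sign_of_pos ha, abs_of_pos hb, mul_one]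
    · rw [Real.sign_of_neg ha, abs_of_neg hb, mul_neg_one, neg_neg]
  simp only [h4, smul_eq_mul, chartIntegrand, (extChartAt I p).left_inv ht.2]
  rw [σ.pullbackDensity_eq_coeff_mul_det _ (hsV ht) ht.2, ← mul_assoc, h6]
  ring

/-- A form supported in a positively oriented embedded simplex can be integrated over that
simplex. -/
theorem integralForm_eq_integral (hσ : Function.Injective σ.1)
    (hpos : ∀ t ∈ simplexDomain n, 0 < σ.pullbackDensity vol.form t) {θ : DiffForm I S n}
    (hθ : θ ∈ smoothForms I S n)
    (h0 : ∀ z, z ∉ σ.param '' interior (simplexDomain n) → θ z = 0) :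
    integralForm vol θ = σ.integral θ := by
  obtain ⟨s, hs⟩ := exists_finset_chartPartition_subset I S
  rw [integralForm_eq_sum vol θ hs]
  simp_rw [σ.integral_chartIntegrand vol hσ hpos h0]
  have hint : ∀ p ∈ s, IntegrableOn
      (fun t => chartPartition I S p (σ.param t) * σ.pullbackDensity θ t) (simplexDomain n) :=
    fun p _ => (((chartPartition I S p).contMDiff.continuous.comp_continuousOn
      σ.continuousOn_param).mul
        (σ.continuousOn_pullbackDensity hθ)).integrableOn_compact (isCompact_simplexDomain n)
  rw [← integral_finsetSum s hint]
  refine integral_congr_ae (Filter.Eventually.of_forall fun t => ?_)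
  have h1 : ∑ p ∈ s, chartPartition I S p (σ.param t) = 1 := by
    rw [← (chartPartition I S).sum_eq_one (Set.mem_univ (σ.param t))]
    exact (finsum_eq_sum_of_support_subset _ fun p hp => hs ⟨_, hp⟩).symm
  simp only
  rw [← Finset.sum_mul, h1, one_mul]

end SmoothSimplex

variable {k : ℕ} {H : Type*} [TopologicalSpace H]
  {I : ModelWithCorners ℝ (EuclideanSpace ℝ (Fin (k + 1))) H}
  {S : Type*} [TopologicalSpace S] [ChartedSpace H S] [IsManifold I ∞ S]
  [T2Space S] [CompactSpace S] [RiemannianBundle (fun x : S => TangentSpace I x)]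
  (vol : RiemannianVolumeForm I S) {R : Type*} [CommRing R] [Algebra R ℝ]

theorem extD_top_eq_zero (θ : smoothForms I S (k + 1)) : extD I S (k + 1) θ = 0 :=
  extD_eq_zero_of_finrank_le (by rw [finrank_euclideanSpace_fin]) θ

/-- Here the local condition at `x` enters. Take `W` to be the open image of the interior of `τ`
minus the compact images of the simplices of `c'`. For a form supported in `W` the chain `c'`
contributes nothing, and boundaries contribute nothing because top-degree forms are closed; only
`τ`, with coefficient `1`, remains. -/
theorem IsFundamentalClass.exists_isOpen {c : smoothCycles I S R k}
    (hc : IsFundamentalClass vol ((smoothBoundaries I S R k).mkQ c)) (x : S) :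
    ∃ W : Set S, IsOpen W ∧ x ∈ W ∧ ∀ θ ∈ smoothForms I S (k + 1), (∀ z, z ∉ W → θ z = 0) →
      integralForm vol θ = chainIntegral θ c.1 := by
  obtain ⟨d, τ, c', b, hd, ⟨hinj, hpos, t, ht, rfl⟩, hc', hdec⟩ := hc x
  refine ⟨τ.param '' interior (simplexDomain (k + 1)) ∩ (⋃ σ ∈ c'.support, Set.range σ.1)ᶜ,
    ?_, ⟨?_, ?_⟩, ?_⟩
  · refine (τ.isOpen_image_param fun t ht => (hpos t ht).ne').inter ?_
    exact (Set.Finite.isClosed_biUnion c'.support.finite_toSet fun σ _ =>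
      σ.isCompact_range.isClosed).isOpen_compl
  · obtain ⟨s, hs, hst⟩ := exists_simplexParam_eq t.2
    refine ⟨s, mem_interior_simplexDomain (fun i => ?_) ?_, ?_⟩
    · simpa [simplexParam] using (ht i.succ).trans_eq (congrFun hst i.succ).symm
    · simpa [simplexParam] using (ht 0).trans_eq (congrFun hst 0).symm
    · rw [τ.param_apply hs]
      exact congrArg τ.1 (Subtype.ext hst)
  · simpa using hc'
  · intro θ hθ h0
    have h1 : chainIntegral θ c.1 = chainIntegral θ d.1 :=
      chainIntegral_eq_of_mkQ_eq (θ := ⟨θ, hθ⟩) (extD_top_eq_zero _) hd.symm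
    have h2 : chainIntegral θ (chainBoundary I S R (k + 1) b) = 0 :=
      chainIntegral_chainBoundary_of_closed (θ := ⟨θ, hθ⟩) (extD_top_eq_zero _) b
    have h3 : chainIntegral θ c' = 0 := by
      refine Finset.sum_eq_zero fun σ hσ => ?_
      have h4 : σ.integral θ = 0 := σ.integral_eq_zero fun z hz => h0 z fun hzW =>
        hzW.2 (Set.mem_biUnion hσ hz)
      simp only [h4, mul_zero]
    rw [τ.integralForm_eq_integral vol hinj hpos hθ fun z hz => h0 z fun hzW => hz hzW.1,
      h1, hdec, chainIntegral_add, chainIntegral_add, h2, h3, chainIntegral_single, map_one,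
      one_mul, add_zero, add_zero]

/-- Integration over a closed oriented manifold is integration over any smooth cycle representing
the fundamental class. -/
theorem IsFundamentalClass.integralForm_eq {c : smoothCycles I S R k}
    (hc : IsFundamentalClass vol ((smoothBoundaries I S R k).mkQ c)) {θ : DiffForm I S (k + 1)}
    (hθ : θ ∈ smoothForms I S (k + 1)) : integralForm vol θ = chainIntegral θ c.1 := by
  choose W hWo hxW hW using hc.exists_isOpen vol
  -- A partition of unity subordinate to the sets `W x` writes `θ` as a finite sum of smooth forms,
  -- each covered by the local statement. It is unrelated to `chartPartition`.
  obtain ⟨χ, hχ⟩ := SmoothPartitionOfUnity.exists_isSubordinate I (isClosed_univ (X := S)) W hWo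
    fun x _ => Set.mem_iUnion.2 ⟨x, hxW x⟩
  let s := χ.finite_ne_zero.toFinset
  let η : S → DiffForm I S (k + 1) := fun i x => χ i x • θ x
  have hη : ∀ i, η i ∈ smoothForms I S (k + 1) := fun i => DiffForm.smul_mem_smoothForms (χ i) hθ
  have hsum : θ = ∑ i ∈ s, η i := by
    funext x
    have h1 : ∑ i ∈ s, χ i x = 1 := by
      rw [← χ.sum_eq_one (Set.mem_univ x)]
      exact (finsum_eq_sum_of_support_subset _ fun i hi =>
        χ.finite_ne_zero.coe_toFinset.symm ▸ ⟨x, hi⟩).symm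
    rw [Finset.sum_apply, ← Finset.sum_smul, h1, one_smul]
  rw [hsum, (DiffForm.HasContinuousCoeff.sum vol fun i _ =>
    DiffForm.hasContinuousCoeff_of_mem_smoothForms (hη i)).2, chainIntegral_sum_form s hη]
  refine Finset.sum_congr rfl fun i _ => hW i (η i) (hη i) fun z hz => ?_
  have h1 : χ i z = 0 := by
    by_contra h
    exact hz (hχ i (subset_tsupport _ h))
  change χ i z • θ z = 0
  rw [h1, zero_smul]

/-- The integral of the pullback of a closed form is the de Rham pairing of its class with the
pushforward of the fundamental class. -/
theorem IsFundamentalClass.integralForm_pullback {vol : RiemannianVolumeForm I S}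
    {z : SmoothHomology I S R k} (hz : IsFundamentalClass vol z)
    {E : Type*} [NormedAddCommGroup E] [NormedSpace ℝ E] {H' : Type*} [TopologicalSpace H']
    {J : ModelWithCorners ℝ E H'} {M : Type*} [TopologicalSpace M] [ChartedSpace H' M]
    [IsManifold J ∞ M] (u : C^∞⟮I, S; J, M⟯) (β : closedForms J M (k + 1)) :
    integralForm vol (DiffForm.pullback u β.1.1) =
      deRhamPairing (deRhamClass β) (pushHomology u z) := by
  obtain ⟨c, rfl⟩ := (smoothBoundaries I S R k).mkQ_surjective z
  rw [deRhamPairing_pushHomology]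
  exact hz.integralForm_eq vol (DiffForm.pullback_mem_smoothForms u β.1.2)

end FundamentalClass

end

/-! ### The main theorem. -/

theorem mainTheorem9 {k m : ℕ} (hk : 1 ≤ k) (hm : k + 1 ≤ m)
    {H : Type*} [TopologicalSpace H] (I : ModelWithCorners ℝ (EuclideanSpace ℝ (Fin (k + 1))) H)
    {S : Type*} [TopologicalSpace S] [ChartedSpace H S] [IsManifold I ∞ S]
    [T2Space S] [CompactSpace S]
    [RiemannianBundle (fun x : S => TangentSpace I x)]
    [IsContMDiffRiemannianBundle I ∞ (EuclideanSpace ℝ (Fin (k + 1)))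
      (fun x : S => TangentSpace I x)]
    (vol : RiemannianVolumeForm I S)
    {M : Type*} [TopologicalSpace M] [ChartedSpace (EuclideanSpace ℝ (Fin m)) M]
    [IsManifold (𝓡 m) ∞ M] [T2Space M] [SigmaCompactSpace M]
    [RiemannianBundle (fun y : M => TangentSpace (𝓡 m) y)]
    [IsContMDiffRiemannianBundle (𝓡 m) ∞ (EuclideanSpace ℝ (Fin m))
      (fun y : M => TangentSpace (𝓡 m) y)]
    (X : VectorCrossProductStructure k m M)
    {R : Type*} [CommRing R] [Algebra R ℝ] :
    (∀ u : C^∞⟮I, S; 𝓡 m, M⟯,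
      nEnergy vol u =
        integralForm vol (energyForm vol u - DiffForm.pullback u X.α.1) +
          integralForm vol (DiffForm.pullback u X.α.1) ∧
      0 ≤ integralForm vol (energyForm vol u - DiffForm.pullback u X.α.1) ∧
      (integralForm vol (energyForm vol u - DiffForm.pullback u X.α.1) = 0 ↔
        IsSmithMap vol X u)) ∧
    (∀ hα : X.α ∈ closedForms (𝓡 m) M (k + 1),
      (∀ u : C^∞⟮I, S; 𝓡 m, M⟯,
        IsSmithMap vol X u ↔ nEnergy vol u = integralForm vol (DiffForm.pullback u X.α.1)) ∧
      (I.boundary S = ∅ → ∀ z : SmoothHomology I S R k, IsFundamentalClass vol z →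
        (∀ u : C^∞⟮I, S; 𝓡 m, M⟯,
          integralForm vol (DiffForm.pullback u X.α.1) =
            deRhamPairing (deRhamClass ⟨X.α, hα⟩) (pushHomology u z)) ∧
        (∀ (u v : C^∞⟮I, S; 𝓡 m, M⟯) (β : closedForms (𝓡 m) M (k + 1)),
          deRhamClass β = deRhamClass ⟨X.α, hα⟩ → pushHomology v z = pushHomology u z →
          integralForm vol (DiffForm.pullback v β.1.1) =
            integralForm vol (DiffForm.pullback u X.α.1)) ∧
        (∀ u : C^∞⟮I, S; 𝓡 m, M⟯,
          IsSmithMap vol X u ↔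
            nEnergy vol u = deRhamPairing (deRhamClass ⟨X.α, hα⟩) (pushHomology u z)) ∧
        (∀ u v : C^∞⟮I, S; 𝓡 m, M⟯,
          IsSmithMap vol X u → pushHomology v z = pushHomology u z →
          nEnergy vol u ≤ nEnergy vol v))) := by
  have h1 := energy_identity hk vol X
  have h2 : ∀ u : C^∞⟮I, S; 𝓡 m, M⟯,
      IsSmithMap vol X u ↔ nEnergy vol u = integralForm vol (DiffForm.pullback u X.α.1) := by
    intro u
    obtain ⟨ha, -, hc⟩ := h1 u
    rw [← hc, ha, add_eq_right]
  refine ⟨h1, fun hα => ⟨h2, fun _ z hz => ?_⟩⟩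
  have h3 : ∀ (u : C^∞⟮I, S; 𝓡 m, M⟯) (β : closedForms (𝓡 m) M (k + 1)),
      integralForm vol (DiffForm.pullback u β.1.1) =
        deRhamPairing (deRhamClass β) (pushHomology u z) := hz.integralForm_pullback
  refine ⟨fun u => h3 u ⟨X.α, hα⟩, fun u v β hβ hvu => ?_, fun u => ?_, fun u v hu hvu => ?_⟩
  · rw [h3 v β, hβ, hvu, ← h3 u ⟨X.α, hα⟩]
  · rw [h2 u, ← h3 u ⟨X.α, hα⟩]
  -- The calibration argument: `E(u) = [α]·u_*[S] = [α]·v_*[S] = ∫ v^*α ≤ E(v)`.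
  · rw [(h2 u).1 hu, (h1 v).1, h3 u ⟨X.α, hα⟩, h3 v ⟨X.α, hα⟩, hvu]
    exact le_add_of_nonneg_left (h1 v).2.1
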